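/- **Setting (multi-leader proof of stake, ML-PoS).** A finite set of parties runs the protocol for $e$ epochs of $l$ slots. In epoch $j$ party $\mathcal P$ holds a fraction $\mu_{\mathcal P,j}\in[0,1]$ of the stake, $\sum_{\mathcal P}\mu_{\mathcal P,j}=1$. In each slot of epoch $j$ every party is a leader with probability $\mu_{\mathcal P,j}$, independently of the other parties and of the other slots; a party learns in each slot whether it leads it. In each slot a party may make up to $q$ queries to a signing oracle, at cost $C>0$ each. A query names a block of the party's view (before the slot) to be extended and a content; it yields a valid block if and only if the party leads the current slot. The index of a block is its height in the tree of blocks rooted at genesis. A party may diffuse any set of blocks of its view, at any time. The router is synchronous and randomized: the set of blocks diffused in a slot is delivered, at the end of the slot, to every party and to a passive observer $\Omega$, to each in an independent uniformly random order. The honest strategy $\Pi$: in each slot that it leads, a party makes one query, extending the longest block it has received (the first received in case of ties), and diffuses the new block; otherwise it does nothing. An arbitrary strategy may use random coins (uniform on a finite set) and chooses queries and diffused blocks as a function of the party's view. At the end, $\Omega$ outputs the longest chain it has received (ties broken by order of arrival), and each party is rewarded with a fixed $R>0$ per block of its own in that chain (block-proportional rewards). For a strategy profile $\sigma$, utility *Reward*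 of a party is its expected reward, and *Profit* is its expected reward minus its expected query cost. **Compliance.** For $\varepsilon\ge 0$, $\sigma'$ is directly $\varepsilon$-reachable from $\sigma$ if they differ only in the strategy of one party $i$, $U_i(\sigma')>U_i(\sigma)+\varepsilon$, and $\sigma'$ is a best response of $i$, i.e. $U_i(\sigma'')\le U_i(\sigma')$ for all $\sigma''$ that agree with $\sigma$ outside $i$. The $\varepsilon$-cone of $\Pi$ consists of the all-honest profile and all profiles reached from it by finitely many such steps. $\mathcal X_{conf}$ holds for a party in a trace if the party created two different valid blocks with the same index. A strategy is $\mathcal X_{conf}$-compliant if $\mathcal X_{conf}$ fails for every party that employs it, in every trace of every profile. $\Pi$ is $(\varepsilon,\mathcal X_{conf})$-compliant if all strategies of all profiles in the $\varepsilon$-cone of $\Pi$ are $\mathcal X_{conf}$-compliant. **Theorem.** Assume $\mu_{\mathcal P',j}<\frac12$ for all parties $\mathcal P'$ and epochs $j$. Let $p_l$ be the probability that multiple leaders are elected in the same slot (if it varies with the epoch, any lower bound for it over all epochs). Let $\mathcal P$ be a party (for instance one of maximum stake), and let $s_{\mathcal P}=\sum_{j=1}^{e} l\cdot\mu_{\mathcal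 P,j}$ be the expected number of slots that $\mathcal P$ leads. 1. *Reward.* For every $\varepsilon\ge0$ with $\varepsilon<\frac{p_l}{2}\cdot R\cdot s_{\mathcal P}$ and all sufficiently large query bounds $q$, the protocol is not $(\varepsilon,\mathcal X_{conf})$-compliant with respect to utility Reward. 2. *Profit.* Let $t=\left\lfloor\sqrt{p_l R/C}\right\rfloor-1$, and assume that $R$ is large enough compared with $C$ that $t\ge1$. For every $\varepsilon\ge0$ with $\varepsilon<\left(\frac{t-1}{2(t+1)}\,p_l R-(t-1)C\right)s_{\mathcal P}$ and every query bound $q\ge t$, the protocol is not $(\varepsilon,\mathcal X_{conf})$-compliant with respect to utility Profit. -/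

import Mathlib

open Filter

/-! ## Compliance: reachability, cones, compliant protocols

`S` is the set of strategies a party may employ and a profile is a function `ι → S`. -/

/-- `σ'` is directly `ε`-reachable from `σ`: one party `i` deviates, gains more than `ε`, and
plays a best response. -/
def DirectlyReachable {ι S : Type*} (U : ι → (ι → S) → ℝ) (ε : ℝ) (σ σ' : ι → S) : Prop :=
  ∃ i, (∀ j, j ≠ i → σ' j = σ j) ∧ U i σ' > U i σ + ε ∧
    ∀ σ'' : ι → S, (∀ j, j ≠ i → σ'' j = σ j) → U i σ'' ≤ U i σ'

/-- The `(ε, U)`-cone of `σ`: `σ` itself and all profiles at the end of a finite path of directly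
`ε`-reachable steps that starts at `σ`. -/
def cone {ι S : Type*} (U : ι → (ι → S) → ℝ) (ε : ℝ) (σ : ι → S) : Set (ι → S) :=
  {σ' | Relation.ReflTransGen (DirectlyReachable U ε) σ σ'}

/-- A strategy is compliant with the infraction predicate `X` if no party that employs it commits
the infraction, in any trace of any profile. `traces σ` is the set of execution traces under `σ`. -/
def IsCompliantStrategy {ι S T : Type*} (traces : (ι → S) → Set T) (X : T → ι → Prop)
    (s : S) : Prop :=
  ∀ (i : ι) (σ : ι → S), σ i = s → ∀ τ ∈ traces σ, ¬ X τ i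

/-- The protocol with honest strategy `honest` is `(ε, X)`-compliant with respect to `U`. -/
def IsCompliantProtocol {ι S T : Type*} (traces : (ι → S) → Set T) (X : T → ι → Prop)
    (U : ι → (ι → S) → ℝ) (honest : S) (ε : ℝ) : Prop :=
  ∀ σ ∈ cone U ε (fun _ => honest), ∀ i, IsCompliantStrategy traces X (σ i)

namespace MLPoS

/-! ## Blocks -/

/-- Blocks form a tree rooted at genesis. A block names the block it extends, its creator, the
slot of its creation and its content (a number that stands for the transactions). Equality of
blocks plays the role of equality of hashes. -/
inductive Block (ι : Type*) where
  | genesis : Block ι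
  | mk (parent : Block ι) (creator : ι) (slot : ℕ) (content : ℕ) : Block ι
  deriving DecidableEq

/-- The index of a block: its height in the tree. -/
def Block.height {ι : Type*} : Block ι → ℕ
  | .genesis => 0
  | .mk p _ _ _ => p.height + 1

/-- The chain that ends in a block, head first, without genesis. -/
def Block.chain {ι : Type*} : Block ι → List (Block ι)
  | .genesis => []
  | .mk p c r x => .mk p c r x :: p.chain

/-- `b` was created by `i`. -/
def Block.CreatedBy {ι : Type*} (i : ι) : Block ι → Prop
  | .genesis => False
  | .mk _ c _ _ => c = i

instance {ι : Type*} [DecidableEq ι] (i : ι) : DecidablePred (Block.CreatedBy i) := fun b => by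
  cases b <;> unfold Block.CreatedBy <;> infer_instance

/-- The longest-chain rule with ties broken by order of arrival: the first block of maximal height
in a list that is ordered by arrival (genesis if there is none). -/
def longest {ι : Type*} (received : List (Block ι)) : Block ι :=
  received.foldl (fun best b => if best.height < b.height then b else best) .genesis

/-! ## Strategies -/

/-- What a party sees in one slot: whether it is a leader of the slot, and the ordered list of
blocks delivered to it at the end of the slot. -/
structure SlotRecord (ι : Type*) where
  isLeader : Bool
  received : List (Block ι)

/-- What a party does in one slot: its queries to the signing oracle, each a block to extend and a
content for the new block, and the blocks it diffuses. -/
structure Action (ι : Type*) where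
  queries : List (Block ι × ℕ)
  diffuse : Finset (Block ι)

/-- A strategy draws random coins uniformly from a finite set at the beginning of the execution;
its action in a slot depends on the coins, the party's identity, the records of all past slots
(oldest first; their number is the current slot), and whether the party leads the current slot. -/
structure Strategy (ι : Type*) where
  coins : ℕ
  act : Fin (coins + 1) → ι → List (SlotRecord ι) → Bool → Action ι

/-- The honest strategy: in every slot that it leads, a party makes one query, which extends its
longest chain, and diffuses the new block; it does nothing in the other slots. -/
def honest (ι : Type*) [DecidableEq ι] : Strategy ι where
  coins := 0
  act _ me past isLeader :=
    let tip := longest (past.flatMap SlotRecord.received)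
    if isLeader then ⟨[(tip, 0)], {.mk tip me past.length 0}⟩ else ⟨[], ∅⟩

/-! ## Leader election -/

/-- Probability that exactly the parties in `L` lead a slot: every party leads with probability
equal to its stake, independently of the other parties. -/
noncomputable def leaderWeight {ι : Type*} [Fintype ι] [DecidableEq ι] (stake : stdSimplex ℝ ι)
    (L : Finset ι) : ℝ :=
  (∏ i ∈ L, stake i) * ∏ i ∈ Lᶜ, (1 - stake i)

theorem leaderWeight_nonneg {ι : Type*} [Fintype ι] [DecidableEq ι] (stake : stdSimplex ℝ ι)
    (L : Finset ι) : 0 ≤ leaderWeight stake L := by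
  have h1 : ∀ i, stake i ≤ 1 := fun i => by
    have h := Finset.single_le_sum (f := fun i => stake i) (fun j _ => stake.2.1 j)
      (Finset.mem_univ i)
    exact h.trans_eq stake.2.2
  exact mul_nonneg (Finset.prod_nonneg fun i _ => stake.2.1 i)
    (Finset.prod_nonneg fun i _ => sub_nonneg.2 (h1 i))

theorem sum_leaderWeight {ι : Type*} [Fintype ι] [DecidableEq ι] (stake : stdSimplex ℝ ι) :
    ∑ L, leaderWeight stake L = 1 := by
  have h := Fintype.prod_add (fun i => stake i) (fun i => 1 - stake i)
  simp only [add_sub_cancel, Finset.prod_const_one] at h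
  exact h.symm

/-- The law of the set of leaders of one slot. -/
noncomputable def leaderLaw {ι : Type*} [Fintype ι] [DecidableEq ι] (stake : stdSimplex ℝ ι) :
    PMF (Finset ι) :=
  PMF.ofFintype (fun L => ENNReal.ofReal (leaderWeight stake L)) (by
    rw [← ENNReal.ofReal_sum_of_nonneg fun L _ => leaderWeight_nonneg stake L,
      sum_leaderWeight, ENNReal.ofReal_one])

/-- The probability that multiple leaders are elected in a slot. -/
noncomputable def multiLeaderProb {ι : Type*} [Fintype ι] [DecidableEq ι]
    (stake : stdSimplex ℝ ι) : ℝ :=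
  ∑ L with 2 ≤ L.card, leaderWeight stake L

/-! ## The router -/

/-- All orderings of a finite set of messages. -/
noncomputable def orderings {ι : Type*} [DecidableEq ι] (msgs : Finset (Block ι)) :
    Finset (List (Block ι)) :=
  msgs.toList.permutations.toFinset

/-- The synchronous router with uniformly randomized order: every message of the slot is delivered
at the end of the slot to every recipient, in an order that is uniformly random, independently for
each recipient. The recipients are the parties (`some i`) and the observer (`none`). -/
noncomputable def router {ι : Type*} [Fintype ι] [DecidableEq ι] (msgs : Finset (Block ι)) :
    PMF (Option ι → List (Block ι)) :=
  PMF.uniformOfFinset (Fintype.piFinset fun _ => orderings msgs)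
    (Fintype.piFinset_nonempty.2 fun _ =>
      ⟨msgs.toList, List.mem_toFinset.2 (List.mem_permutations.2 (List.Perm.refl _))⟩)

/-! ## Executions -/

/-- Parameters of an execution: the stake distribution of each epoch, the number of epochs, the
number of slots per epoch, and the number of oracle queries available to a party per slot. -/
structure Params (ι : Type*) [Fintype ι] where
  stake : ℕ → stdSimplex ℝ ι
  epochs : ℕ
  slotsPerEpoch : ℕ
  queryBound : ℕ

/-- An execution trace: the slot records of every party (oldest first), the blocks received by the
observer in order of arrival, the valid blocks created by every party (whether diffused or not),
and the number of oracle queries made by every party. -/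
structure Trace (ι : Type*) where
  records : ι → List (SlotRecord ι)
  observed : List (Block ι)
  created : ι → Finset (Block ι)
  queries : ι → ℕ

/-- The trace before the first slot. -/
def Trace.init (ι : Type*) : Trace ι := ⟨fun _ => [], [], fun _ => ∅, fun _ => 0⟩

/-- The blocks in the view of party `i`: genesis, the blocks it received or created, and their
ancestors. -/
def Trace.known {ι : Type*} [DecidableEq ι] (τ : Trace ι) (i : ι) : Finset (Block ι) :=
  insert .genesis
    ((((τ.records i).flatMap SlotRecord.received).toFinset ∪ τ.created i).biUnion
      fun b => b.chain.toFinset)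

/-- The queries that party `i` makes in a slot: at most `q` of those in its action. -/
def queriesOf {ι : Type*} (q : ℕ) (a : Action ι) : List (Block ι × ℕ) := a.queries.take q

/-- The valid blocks created by party `i` in slot `r`. Only a leader of the slot obtains valid
blocks from the oracle, one per query, and a block extends a block that was in the view of its
creator at the beginning of the slot. Hence the slots along a chain are strictly increasing, and a
leader cannot extend a chain by several blocks of the same slot. -/
def newBlocks {ι : Type*} [DecidableEq ι] (q : ℕ) (τ : Trace ι) (r : ℕ) (L : Finset ι) (i : ι)
    (a : Action ι) : Finset (Block ι) :=
  if i ∈ L then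
    (((queriesOf q a).filter fun x => x.1 ∈ τ.known i).map fun x => .mk x.1 i r x.2).toFinset
  else ∅

/-- One slot of the execution, in which the parties follow the rules `act`: the leaders are
elected, the parties query the oracle and diffuse blocks of their views, and the router delivers
the set of diffused blocks. -/
noncomputable def step {ι : Type*} [Fintype ι] [DecidableEq ι] (G : Params ι)
    (act : ι → List (SlotRecord ι) → Bool → Action ι) (r : ℕ) (τ : Trace ι) : PMF (Trace ι) :=
  (leaderLaw (G.stake (r / G.slotsPerEpoch))).bind fun L =>
    let a : ι → Action ι := fun i => act i (τ.records i) (decide (i ∈ L))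
    let new : ι → Finset (Block ι) := fun i => newBlocks G.queryBound τ r L i (a i)
    let msgs : Finset (Block ι) :=
      Finset.univ.biUnion fun i => (a i).diffuse ∩ (τ.known i ∪ new i)
    (router msgs).map fun o =>
      { records := fun i => τ.records i ++ [⟨decide (i ∈ L), o (some i)⟩]
        observed := τ.observed ++ o none
        created := fun i => τ.created i ∪ new i
        queries := fun i => τ.queries i + (queriesOf G.queryBound (a i)).length }

/-- The law of the trace after the first `r` slots (numbered from `0`). -/
noncomputable def run {ι : Type*} [Fintype ι] [DecidableEq ι] (G : Params ι)
    (act : ι → List (SlotRecord ι) → Bool → Action ι) : ℕ → PMF (Trace ι)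
  | 0 => PMF.pure (Trace.init ι)
  | r + 1 => (run G act r).bind (step G act r)

/-- The execution under a strategy profile: the law of the trace at the end of the last epoch, over
the coins of the parties, the leader election and the router. -/
noncomputable def execution {ι : Type*} [Fintype ι] [DecidableEq ι] (G : Params ι)
    (σ : ι → Strategy ι) : PMF (Trace ι) :=
  (PMF.uniformOfFintype (∀ i, Fin ((σ i).coins + 1))).bind fun ω =>
    run G (fun i => (σ i).act (ω i) i) (G.epochs * G.slotsPerEpoch)

/-- The execution traces that can occur under a strategy profile. -/
def traces {ι : Type*} [Fintype ι] [DecidableEq ι] (G : Params ι) (σ : ι → Strategy ι) :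
    Set (Trace ι) :=
  (execution G σ).support

/-- The conflicting predicate: the party created two different valid blocks of the same index. -/
def Conflicting {ι : Type*} (τ : Trace ι) (i : ι) : Prop :=
  ∃ b ∈ τ.created i, ∃ b' ∈ τ.created i, b.height = b'.height ∧ b ≠ b'

/-! ## Rewards, costs and utilities -/

/-- The chain output by the observer. -/
def Trace.observerChain {ι : Type*} (τ : Trace ι) : List (Block ι) := (longest τ.observed).chain

/-- The number of blocks of party `i` in a chain. -/
def blocksOf {ι : Type*} [DecidableEq ι] (c : List (Block ι)) (i : ι) : ℕ :=
  c.countP fun b => decide (Block.CreatedBy i b)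

/-- The proportional reward function: the fraction of the blocks of the chain that were created by
`i` (equal shares for the empty chain, for which nothing is distributed). -/
noncomputable def share {ι : Type*} [Fintype ι] [DecidableEq ι] (c : List (Block ι)) (i : ι) : ℝ :=
  if c.length = 0 then 1 / Fintype.card ι else blocksOf c i / c.length

/-- Block-proportional rewards with a fixed reward `R` per block of the observer's chain. -/
noncomputable def reward {ι : Type*} [Fintype ι] [DecidableEq ι] (R : ℝ) (τ : Trace ι) (i : ι) :
    ℝ :=
  share τ.observerChain i * (τ.observerChain.length * R)

theorem reward_eq {ι : Type*} [Fintype ι] [DecidableEq ι] (R : ℝ) (τ : Trace ι) (i : ι) :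
    reward R τ i = blocksOf τ.observerChain i * R := by
  unfold reward share
  split_ifs with h
  · simp [blocksOf, List.length_eq_zero_iff.1 h]
  · have : (τ.observerChain.length : ℝ) ≠ 0 := Nat.cast_ne_zero.2 h
    field_simp

/-- The cost of party `i`: `C` per oracle query. -/
def cost {ι : Type*} (C : ℝ) (τ : Trace ι) (i : ι) : ℝ := τ.queries i * C

/-- Expectation over the execution traces (finitely many traces have positive probability). -/
noncomputable def expectation {α : Type*} (p : PMF α) (f : α → ℝ) : ℝ :=
  ∑' x, (p x).toReal * f x

/-- Utility Reward: expected rewards. -/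
noncomputable def rewardUtility {ι : Type*} [Fintype ι] [DecidableEq ι] (G : Params ι) (R : ℝ)
    (i : ι) (σ : ι → Strategy ι) : ℝ :=
  expectation (execution G σ) fun τ => reward R τ i

/-- Utility Profit: expected rewards minus expected cost. -/
noncomputable def profitUtility {ι : Type*} [Fintype ι] [DecidableEq ι] (G : Params ι) (R C : ℝ)
    (i : ι) (σ : ι → Strategy ι) : ℝ :=
  (expectation (execution G σ) fun τ => reward R τ i) -
    expectation (execution G σ) fun τ => cost C τ i

/-- The expected number of slots that party `i` leads. -/
noncomputable def expectedSlots {ι : Type*} [Fintype ι] (stake : ℕ → stdSimplex ℝ ι)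
    (epochs slotsPerEpoch : ℕ) (i : ι) : ℝ :=
  ∑ j ∈ Finset.range epochs, (slotsPerEpoch : ℝ) * stake j i

end MLPoS

/-! Consider the deviation in which `P`, whenever it leads, signs `t` sibling blocks on its longest
chain and diffuses them all, while everybody else is honest. All recipients then always have longest
chains of one common height. In a slot with `k` other leaders the next block of each recipient is
uniform among `t + k` candidates, by the symmetry of the router. So `P` wins the slot with
probability `t / (t + k)` instead of `1 / (1 + k)`. The tips of different recipients may differ, but
the expected number of blocks of `P` is affine in the numbers at the tips, with coefficients that do
not depend on the state (`exists_value_ownTip`), so the gains of the slots simply add up. The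
difference of the two probabilities, averaged over `k`, is at least `(t - 1) / (2 * (t + 1))` times
the probability of multiple leaders (`multiLeaderProb_le`, `siblingGain_sub_ge`); this uses that the
stake of `P` is below `1 / 2` and that the second moment of a sum of independent Bernoulli variables
is at most mean plus squared mean.

A step in the cone must be a best response, and the sibling deviation need not be one. A best
response exists because the query bound leaves only finitely many values of the expected profit
(`finite_values`, `exists_best_rule`); it may be taken deterministic, since coins only average over
rules. It gains at least as much as the siblings, hence is reachable from the honest profile.

It remains to see that this best response creates conflicts. Suppose it does not, and let `r` be the
last slot in which `P` has stake. With positive probability `P` has led no slot before `r`. In this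
event `P` has no blocks, public or secret, and no chance to lead after `r`, so neither withholding
nor later play complicates the comparison. Without conflicts `P` has at most one competing block in
slot `r`. It therefore earns at most what one block brings, or nothing if it makes no query, whereas
`t` siblings earn strictly more than both alternatives. Switching to siblings in exactly this event
(`splicedRule`) is a strict improvement (`exists_better_rule`), a contradiction.

Reward is Profit at cost `0`; there `t = q` is affordable, and `(q - 1) / (2 * (q + 1))` tends to `1
/ 2`. -/

namespace MLPoS

/-! ### Expectations under laws of finite support -/

section Expectation

variable {α β : Type*}

theorem expectation_eq_sum (p : PMF α) (f : α → ℝ) (s : Finset α) (h : p.support ⊆ s) :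
    expectation p f = ∑ x ∈ s, (p x).toReal * f x := by
  refine tsum_eq_sum fun x hx => ?_
  have : p x = 0 := by
    by_contra h0
    exact hx (h ((p.mem_support_iff x).2 h0))
  simp [this]

theorem expectation_pure (a : α) (f : α → ℝ) : expectation (PMF.pure a) f = f a := by
  classical
  rw [expectation_eq_sum _ _ {a} (by simp)]
  simp

theorem sum_toReal_eq_one (p : PMF α) (s : Finset α) (h : p.support ⊆ s) :
    ∑ x ∈ s, (p x).toReal = 1 := by
  rw [← ENNReal.toReal_sum fun x _ => p.apply_ne_top x]
  have : ∑ x ∈ s, p x = 1 := by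
    rw [← p.tsum_coe]
    refine (tsum_eq_sum fun x hx => ?_).symm
    by_contra h0
    exact hx (h ((p.mem_support_iff x).2 h0))
  simp [this]

theorem finite_support_bind (p : PMF α) (f : α → PMF β) (hp : p.support.Finite)
    (hf : ∀ a, (f a).support.Finite) : (p.bind f).support.Finite := by
  rw [PMF.support_bind]
  exact hp.biUnion fun a _ => hf a

theorem expectation_bind (p : PMF α) (f : α → PMF β) (g : β → ℝ) (hp : p.support.Finite)
    (hf : ∀ a, (f a).support.Finite) :
    expectation (p.bind f) g = expectation p fun a => expectation (f a) g := by
  classical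
  have hb := finite_support_bind p f hp hf
  have hsub : ∀ a ∈ p.support, (f a).support ⊆ hb.toFinset := fun a ha b hb' => by
    rw [Set.Finite.coe_toFinset, PMF.support_bind]
    exact Set.mem_biUnion ha hb'
  rw [expectation_eq_sum (p.bind f) g hb.toFinset (by simp),
    expectation_eq_sum p _ hp.toFinset (by simp)]
  have h1 : ∀ a ∈ hp.toFinset, (p a).toReal * expectation (f a) g =
      ∑ b ∈ hb.toFinset, (p a).toReal * ((f a b).toReal * g b) := fun a ha => by
    rw [expectation_eq_sum (f a) g _ (hsub a (by simpa using ha)), Finset.mul_sum]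
  rw [Finset.sum_congr rfl h1, Finset.sum_comm]
  refine Finset.sum_congr rfl fun b _ => ?_
  have h2 : (p.bind f) b = ∑ a ∈ hp.toFinset, p a * f a b := by
    rw [PMF.bind_apply]
    refine tsum_eq_sum fun a ha => ?_
    have : p a = 0 := by
      by_contra h0
      exact ha (by simpa using h0)
    simp [this]
  rw [h2, ENNReal.toReal_sum fun a _ => ENNReal.mul_ne_top (p.apply_ne_top a)
    ((f a).apply_ne_top b), Finset.sum_mul]
  refine Finset.sum_congr rfl fun a _ => ?_
  rw [ENNReal.toReal_mul, mul_assoc]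

theorem expectation_sub (p : PMF α) (hp : p.support.Finite) (f g : α → ℝ) :
    expectation p (fun x => f x - g x) = expectation p f - expectation p g := by
  simp only [expectation_eq_sum p _ hp.toFinset (by simp), mul_sub, Finset.sum_sub_distrib]

theorem expectation_le_of_forall_le (p : PMF α) (hp : p.support.Finite) (f : α → ℝ) (M : ℝ)
    (h : ∀ x, f x ≤ M) : expectation p f ≤ M := by
  rw [expectation_eq_sum p f hp.toFinset (by simp)]
  calc ∑ x ∈ hp.toFinset, (p x).toReal * f x ≤ ∑ x ∈ hp.toFinset, (p x).toReal * M :=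
        Finset.sum_le_sum fun x _ => mul_le_mul_of_nonneg_left (h x) ENNReal.toReal_nonneg
    _ = M := by rw [← Finset.sum_mul, sum_toReal_eq_one p _ (by simp), one_mul]

theorem expectation_const (p : PMF α) (hp : p.support.Finite) (c : ℝ) :
    expectation p (fun _ => c) = c := by
  rw [expectation_eq_sum p _ hp.toFinset (by simp), ← Finset.sum_mul,
    sum_toReal_eq_one p _ (by simp), one_mul]

theorem expectation_uniformOfFinset (s : Finset α) (hs : s.Nonempty) (f : α → ℝ) :
    expectation (PMF.uniformOfFinset s hs) f = s.expect f := by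
  rw [expectation_eq_sum _ f s (by simp), Finset.expect_eq_sum_div_card, Finset.sum_div]
  refine Finset.sum_congr rfl fun x hx => ?_
  rw [PMF.uniformOfFinset_apply_of_mem hs hx, ENNReal.toReal_inv, ENNReal.toReal_natCast]
  field_simp

end Expectation

/-! ### Executions as finite recursions over slots -/

section Value

variable {ι : Type*} [Fintype ι] [DecidableEq ι]

/-- The deliveries that the router may make: an ordering of the messages for each recipient. -/
noncomputable def deliveries (msgs : Finset (Block ι)) : Finset (Option ι → List (Block ι)) :=
  Fintype.piFinset fun _ => orderings msgs

theorem mem_orderings {ι : Type*} [DecidableEq ι] {msgs : Finset (Block ι)} {l : List (Block ι)} :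
    l ∈ orderings msgs ↔ l.Perm msgs.toList := by
  simp [orderings, List.mem_permutations]

theorem mem_of_mem_orderings {ι : Type*} [DecidableEq ι] {msgs : Finset (Block ι)}
    {l : List (Block ι)} (h : l ∈ orderings msgs) {b : Block ι} : b ∈ l ↔ b ∈ msgs := by
  rw [(mem_orderings.1 h).mem_iff, Finset.mem_toList]

theorem mem_deliveries {msgs : Finset (Block ι)} {o : Option ι → List (Block ι)} :
    o ∈ deliveries msgs ↔ ∀ x, o x ∈ orderings msgs := by
  simp [deliveries]

theorem deliveries_nonempty (msgs : Finset (Block ι)) : (deliveries msgs).Nonempty :=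
  ⟨fun _ => msgs.toList, mem_deliveries.2 fun _ => mem_orderings.2 (List.Perm.refl _)⟩

/-- The messages that are diffused in a slot with leaders `L`. -/
def slotMessages (G : Params ι) (act : ι → List (SlotRecord ι) → Bool → Action ι) (r : ℕ)
    (τ : Trace ι) (L : Finset ι) : Finset (Block ι) :=
  Finset.univ.biUnion fun i => (act i (τ.records i) (decide (i ∈ L))).diffuse ∩
    (τ.known i ∪ newBlocks G.queryBound τ r L i (act i (τ.records i) (decide (i ∈ L))))

/-- The trace after a slot with leaders `L` and delivery `o`. -/
def nextTrace (G : Params ι) (act : ι → List (SlotRecord ι) → Bool → Action ι) (r : ℕ)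
    (τ : Trace ι) (L : Finset ι) (o : Option ι → List (Block ι)) : Trace ι where
  records i := τ.records i ++ [⟨decide (i ∈ L), o (some i)⟩]
  observed := τ.observed ++ o none
  created i := τ.created i ∪
    newBlocks G.queryBound τ r L i (act i (τ.records i) (decide (i ∈ L)))
  queries i := τ.queries i +
    (queriesOf G.queryBound (act i (τ.records i) (decide (i ∈ L)))).length

theorem step_eq (G : Params ι) (act : ι → List (SlotRecord ι) → Bool → Action ι) (r : ℕ)
    (τ : Trace ι) : step G act r τ = (leaderLaw (G.stake (r / G.slotsPerEpoch))).bind fun L =>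
      (router (slotMessages G act r τ L)).map (nextTrace G act r τ L) := rfl

/-- The weight of the set `L` of leaders in slot `r`. -/
noncomputable def slotWeight (G : Params ι) (r : ℕ) (L : Finset ι) : ℝ :=
  leaderWeight (G.stake (r / G.slotsPerEpoch)) L

theorem slotWeight_nonneg (G : Params ι) (r : ℕ) (L : Finset ι) : 0 ≤ slotWeight G r L :=
  leaderWeight_nonneg _ _

theorem sum_slotWeight (G : Params ι) (r : ℕ) : ∑ L, slotWeight G r L = 1 :=
  sum_leaderWeight _

theorem mem_support_leaderLaw (G : Params ι) (r : ℕ) (L : Finset ι) :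
    L ∈ (leaderLaw (G.stake (r / G.slotsPerEpoch))).support ↔ slotWeight G r L ≠ 0 := by
  rw [PMF.mem_support_iff, leaderLaw, PMF.ofFintype_apply]
  have := slotWeight_nonneg G r L
  simp only [ne_eq, ENNReal.ofReal_eq_zero, not_le, slotWeight] at this ⊢
  exact ⟨fun h => h.ne', fun h => lt_of_le_of_ne this (Ne.symm h)⟩

/-- Traces that can follow `τ` after slot `r`. -/
def Follows (G : Params ι) (act : ι → List (SlotRecord ι) → Bool → Action ι) (r : ℕ)
    (τ τ' : Trace ι) : Prop :=
  ∃ L, slotWeight G r L ≠ 0 ∧ ∃ o ∈ deliveries (slotMessages G act r τ L),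
    nextTrace G act r τ L o = τ'

theorem mem_support_router (msgs : Finset (Block ι)) (o : Option ι → List (Block ι)) :
    o ∈ (router msgs).support ↔ o ∈ deliveries msgs := by
  rw [router, PMF.mem_support_uniformOfFinset_iff, deliveries]

theorem mem_support_step (G : Params ι) (act : ι → List (SlotRecord ι) → Bool → Action ι) (r : ℕ)
    (τ τ' : Trace ι) : τ' ∈ (step G act r τ).support ↔ Follows G act r τ τ' := by
  simp only [step_eq, PMF.mem_support_bind_iff, PMF.mem_support_map_iff, mem_support_leaderLaw,
    mem_support_router, Follows]

theorem finite_support_router (msgs : Finset (Block ι)) : (router msgs).support.Finite :=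
  (deliveries msgs).finite_toSet.subset fun o ho => (mem_support_router msgs o).1 ho

theorem finite_support_map {α β : Type*} (p : PMF α) (f : α → β) (hp : p.support.Finite) :
    (p.map f).support.Finite := by
  rw [PMF.support_map]
  exact hp.image f

theorem finite_support_step (G : Params ι) (act : ι → List (SlotRecord ι) → Bool → Action ι)
    (r : ℕ) (τ : Trace ι) : (step G act r τ).support.Finite :=
  finite_support_bind _ _ (Set.toFinite _) fun _ => finite_support_map _ _ (finite_support_router _)

theorem finite_support_run (G : Params ι) (act : ι → List (SlotRecord ι) → Bool → Action ι) :
    ∀ r, (run G act r).support.Finite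
  | 0 => by simp [run]
  | r + 1 => finite_support_bind _ _ (finite_support_run G act r) (finite_support_step G act r)

/-- The expectation of `f` after slot `r`, if the trace before the slot is `τ`. -/
noncomputable def slotMean (G : Params ι) (act : ι → List (SlotRecord ι) → Bool → Action ι)
    (r : ℕ) (f : Trace ι → ℝ) (τ : Trace ι) : ℝ :=
  ∑ L, slotWeight G r L *
    (deliveries (slotMessages G act r τ L)).expect fun o => f (nextTrace G act r τ L o)

/-- The expectation of `f` after the `n` slots from slot `r` on, if the trace before slot `r`
is `τ`. -/
noncomputable def value (G : Params ι) (act : ι → List (SlotRecord ι) → Bool → Action ι) :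
    ℕ → ℕ → (Trace ι → ℝ) → Trace ι → ℝ
  | _, 0, f => f
  | r, n + 1, f => slotMean G act r (value G act (r + 1) n f)

theorem expectation_step (G : Params ι) (act : ι → List (SlotRecord ι) → Bool → Action ι)
    (r : ℕ) (f : Trace ι → ℝ) (τ : Trace ι) :
    expectation (step G act r τ) f = slotMean G act r f τ := by
  rw [step_eq, expectation_bind _ _ _ (Set.toFinite _)
    fun _ => finite_support_map _ _ (finite_support_router _),
    expectation_eq_sum _ _ Finset.univ (by simp), slotMean]
  refine Finset.sum_congr rfl fun L _ => ?_
  congr 1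
  · rw [leaderLaw, PMF.ofFintype_apply, ENNReal.toReal_ofReal (leaderWeight_nonneg _ _)]
    rfl
  · rw [PMF.map, expectation_bind _ _ _ (finite_support_router _) (by simp)]
    simp only [Function.comp_apply, expectation_pure]
    rw [router, expectation_uniformOfFinset]
    rfl

variable (G : Params ι) (act : ι → List (SlotRecord ι) → Bool → Action ι)

/-- `value` recurses on the first slot and `run` on the last one; this reconciles the two
recursions. -/
theorem value_succ_right (r n : ℕ) (f : Trace ι → ℝ) :
    value G act r (n + 1) f = value G act r n (slotMean G act (r + n) f) := by
  induction n generalizing r with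
  | zero => rfl
  | succ n ih =>
    rw [value, ih (r + 1), value, show r + 1 + n = r + (n + 1) by omega]

theorem value_add (r n k : ℕ) (f : Trace ι → ℝ) :
    value G act r (n + k) f = value G act r n (value G act (r + n) k f) := by
  induction n generalizing r with
  | zero => simp [value]
  | succ n ih =>
    rw [show n + 1 + k = (n + k) + 1 by omega, value, ih (r + 1), value,
      show r + 1 + n = r + (n + 1) by omega]

theorem expectation_run (r : ℕ) (f : Trace ι → ℝ) :
    expectation (run G act r) f = value G act 0 r f (Trace.init ι) := by
  induction r generalizing f with
  | zero => exact expectation_pure _ _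
  | succ r ih =>
    rw [run, expectation_bind _ _ _ (finite_support_run G act r) (finite_support_step G act r),
      value_succ_right, ← ih, zero_add]
    congr 1
    funext τ
    exact expectation_step G act r f τ

theorem slotMean_mono_of_follows (r : ℕ) {f g : Trace ι → ℝ} {τ : Trace ι}
    (h : ∀ τ', Follows G act r τ τ' → f τ' ≤ g τ') :
    slotMean G act r f τ ≤ slotMean G act r g τ := by
  refine Finset.sum_le_sum fun L _ => ?_
  rcases eq_or_ne (slotWeight G r L) 0 with h0 | h0
  · simp [h0]
  · exact mul_le_mul_of_nonneg_left
      (Finset.expect_le_expect fun o ho => h _ ⟨L, h0, o, ho, rfl⟩) (slotWeight_nonneg _ _ _)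

/-- Values are monotone; only traces with an invariant `J` matter. -/
theorem value_mono (J : ℕ → Trace ι → Prop) {f g : Trace ι → ℝ} (r n : ℕ) {τ : Trace ι}
    (hJ : ∀ k, r ≤ k → k < r + n → ∀ τ τ', J k τ → Follows G act k τ τ' → J (k + 1) τ')
    (hτ : J r τ) (h : ∀ τ', J (r + n) τ' → f τ' ≤ g τ') :
    value G act r n f τ ≤ value G act r n g τ := by
  induction n generalizing r τ with
  | zero => exact h τ hτ
  | succ n ih =>
    refine slotMean_mono_of_follows G act r fun τ' hτ' => ?_
    refine ih (r + 1) (fun k h1 h2 => hJ k (by omega) (by omega))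
      (hJ r le_rfl (by omega) τ τ' hτ hτ') ?_
    rwa [show r + 1 + n = r + (n + 1) by omega]

theorem slotMean_add (r : ℕ) (f g : Trace ι → ℝ) (τ : Trace ι) :
    slotMean G act r (fun τ => f τ + g τ) τ = slotMean G act r f τ + slotMean G act r g τ := by
  simp only [slotMean, Finset.expect_add_distrib, mul_add, Finset.sum_add_distrib]

theorem slotMean_const_mul (r : ℕ) (c : ℝ) (f : Trace ι → ℝ) (τ : Trace ι) :
    slotMean G act r (fun τ => c * f τ) τ = c * slotMean G act r f τ := by
  simp only [slotMean, ← Finset.mul_expect, Finset.mul_sum]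
  exact Finset.sum_congr rfl fun L _ => by ring

theorem slotMean_const (r : ℕ) (c : ℝ) (τ : Trace ι) : slotMean G act r (fun _ => c) τ = c := by
  simp only [slotMean, Finset.expect_const (deliveries_nonempty _), ← Finset.sum_mul,
    sum_slotWeight, one_mul]

theorem value_add_fun (r n : ℕ) (f g : Trace ι → ℝ) (τ : Trace ι) :
    value G act r n (fun τ => f τ + g τ) τ = value G act r n f τ + value G act r n g τ := by
  induction n generalizing r τ with
  | zero => rfl
  | succ n ih =>
    rw [value, value, value, ← slotMean_add]
    congr 1
    funext τ
    exact ih (r + 1) τ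

theorem value_const_mul (r n : ℕ) (c : ℝ) (f : Trace ι → ℝ) (τ : Trace ι) :
    value G act r n (fun τ => c * f τ) τ = c * value G act r n f τ := by
  induction n generalizing r τ with
  | zero => rfl
  | succ n ih =>
    rw [value, value, ← slotMean_const_mul]
    congr 1
    funext τ
    exact ih (r + 1) τ

theorem value_sub_fun (r n : ℕ) (f g : Trace ι → ℝ) (τ : Trace ι) :
    value G act r n (fun τ => f τ - g τ) τ = value G act r n f τ - value G act r n g τ := by
  have h : (fun τ => f τ - g τ) = fun τ => f τ + (-1) * g τ := by
    funext τ
    ring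
  rw [h, value_add_fun, value_const_mul]
  ring

theorem value_const (r n : ℕ) (c : ℝ) (τ : Trace ι) : value G act r n (fun _ => c) τ = c := by
  induction n generalizing r τ with
  | zero => rfl
  | succ n ih =>
    have : value G act (r + 1) n (fun _ => c) = fun _ => c := funext (ih (r + 1))
    rw [value, this, slotMean_const]

theorem value_nonneg (r n : ℕ) {f : Trace ι → ℝ} (hf : ∀ τ, 0 ≤ f τ) (τ : Trace ι) :
    0 ≤ value G act r n f τ := by
  rw [← value_const G act r n 0 τ]
  exact value_mono G act (fun _ _ => True) r n (fun _ _ _ _ _ _ _ => trivial) trivial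
    fun τ _ => hf τ

/-- Values only depend on what the parties do in traces with an invariant `J`. -/
theorem value_congr_act {act' : ι → List (SlotRecord ι) → Bool → Action ι}
    (J : ℕ → Trace ι → Prop) (r n : ℕ) (f : Trace ι → ℝ) {τ : Trace ι}
    (hJ : ∀ k, r ≤ k → k < r + n → ∀ τ τ', J k τ → Follows G act k τ τ' → J (k + 1) τ')
    (hact : ∀ k, r ≤ k → k < r + n → ∀ τ, J k τ → ∀ i,
      act i (τ.records i) = act' i (τ.records i))
    (hτ : J r τ) : value G act r n f τ = value G act' r n f τ := by
  induction n generalizing r τ with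
  | zero => rfl
  | succ n ih =>
    have h1 : ∀ i, act i (τ.records i) = act' i (τ.records i) := hact r le_rfl (by omega) τ hτ
    have h2 : slotMean G act r (value G act' (r + 1) n f) τ =
        slotMean G act' r (value G act' (r + 1) n f) τ := by
      simp only [slotMean, slotMessages, nextTrace, h1]
    rw [value, value, ← h2]
    have h3 : ∀ τ', Follows G act r τ τ' →
        value G act (r + 1) n f τ' = value G act' (r + 1) n f τ' := fun τ' h' =>
      ih (r + 1) (fun k h1 h2 => hJ k (by omega) (by omega))
        (fun k h1 h2 => hact k (by omega) (by omega)) (hJ r le_rfl (by omega) τ τ' hτ h')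
    exact le_antisymm (slotMean_mono_of_follows G act r fun τ' h' => (h3 τ' h').le)
      (slotMean_mono_of_follows G act r fun τ' h' => (h3 τ' h').ge)

end Value

/-! ### The longest-chain rule -/

section Longest

variable {ι : Type*}

theorem foldl_longest_of_le (l : List (Block ι)) (best : Block ι)
    (h : ∀ b ∈ l, b.height ≤ best.height) :
    l.foldl (fun best b => if best.height < b.height then b else best) best = best := by
  induction l with
  | nil => rfl
  | cons b l ih =>
    rw [List.foldl_cons, if_neg (not_lt.2 (h b (by simp)))]
    exact ih fun b' hb' => h b' (by simp [hb'])

/-- Once a block of height `best.height + 1` has arrived, the bound on heights excludes any further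
improvement, and ties favour the first arrival. -/
theorem foldl_longest (l : List (Block ι)) (best : Block ι)
    (h : ∀ b ∈ l, b.height ≤ best.height + 1) :
    l.foldl (fun best b => if best.height < b.height then b else best) best =
      (l.find? fun b => decide (best.height < b.height)).getD best := by
  induction l with
  | nil => rfl
  | cons b l ih =>
    rw [List.foldl_cons]
    by_cases hb : best.height < b.height
    · rw [if_pos hb, foldl_longest_of_le l b fun b' hb' => (h b' (by simp [hb'])).trans hb]
      simp [hb]
    · rw [if_neg hb, ih fun b' hb' => h b' (by simp [hb'])]
      simp [hb]

/-- If no received block is longer by more than one than the longest one received so far, then the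
first one that is longer becomes the longest one. -/
theorem longest_append (old l : List (Block ι))
    (h : ∀ b ∈ l, b.height ≤ (longest old).height + 1) :
    longest (old ++ l) =
      (l.find? fun b => decide ((longest old).height < b.height)).getD (longest old) := by
  rw [longest, List.foldl_append]
  exact foldl_longest l _ h

theorem foldl_longest_mem (l : List (Block ι)) (best : Block ι) :
    l.foldl (fun best b => if best.height < b.height then b else best) best = best ∨
      l.foldl (fun best b => if best.height < b.height then b else best) best ∈ l := by
  induction l generalizing best with
  | nil => exact Or.inl rfl
  | cons b l ih =>
    rw [List.foldl_cons]
    split_ifs with h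
    · rcases ih b with h | h
      · exact Or.inr (by simp [h])
      · exact Or.inr (by simp [h])
    · rcases ih best with h | h
      · exact Or.inl h
      · exact Or.inr (by simp [h])

theorem longest_mem (l : List (Block ι)) : longest l = .genesis ∨ longest l ∈ l :=
  foldl_longest_mem l _

end Longest

/-! ### Symmetry of the randomized router -/

theorem orderings_map_swap {ι : Type*} [DecidableEq ι] {msgs : Finset (Block ι)}
    {b b' : Block ι} (hb : b ∈ msgs) (hb' : b' ∈ msgs) {l : List (Block ι)} (hl : l ∈ orderings msgs) :
    l.map (Equiv.swap b b') ∈ orderings msgs := by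
  have hn : l.Nodup := (mem_orderings.1 hl).nodup_iff.2 msgs.nodup_toList
  rw [mem_orderings, List.perm_ext_iff_of_nodup (hn.map (Equiv.injective _)) msgs.nodup_toList]
  intro a
  rw [List.mem_map, Finset.mem_toList]
  simp only [mem_of_mem_orderings hl]
  have key : ∀ c ∈ msgs, Equiv.swap b b' c ∈ msgs := fun c hc => by
    rw [Equiv.swap_apply_def]
    split_ifs <;> assumption
  exact ⟨fun ⟨c, hc, h⟩ => h ▸ key c hc, fun ha => ⟨_, key a ha, by simp⟩⟩

/-- In a uniformly random delivery, the first block with a given property that reaches a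
given recipient is uniformly distributed. -/
theorem expect_deliveries_find {ι : Type*} [Fintype ι] [DecidableEq ι]
    (msgs : Finset (Block ι)) (p : Block ι → Bool) (x : Option ι)
    (φ : Block ι → ℝ) (d : Block ι) (hne : (msgs.filter fun b => p b).Nonempty) :
    ((deliveries msgs).expect fun o => φ (((o x).find? p).getD d)) =
      (msgs.filter fun b => p b).expect φ := by
  set H := msgs.filter fun b => p b with hH
  set F : (Option ι → List (Block ι)) → Block ι := fun o => ((o x).find? p).getD d with hF
  have hmaps : ∀ o ∈ deliveries msgs, F o ∈ H := fun o ho => by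
    have ho := mem_deliveries.1 ho x
    rcases h : (o x).find? p with _ | c
    · obtain ⟨b, hb⟩ := hne
      rw [hH, Finset.mem_filter] at hb
      exact absurd hb.2 (List.find?_eq_none.1 h b ((mem_of_mem_orderings ho).2 hb.1))
    · simp only [hF, h, Option.getD_some, hH, Finset.mem_filter]
      exact ⟨(mem_of_mem_orderings ho).1 (List.mem_of_find?_eq_some h), List.find?_some h⟩
  have hle : ∀ b ∈ H, ∀ b' ∈ H, ((deliveries msgs).filter fun o => F o = b).card ≤
      ((deliveries msgs).filter fun o => F o = b').card := fun b hb b' hb' => by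
    have hpb := (Finset.mem_filter.1 hb)
    have hpb' := (Finset.mem_filter.1 hb')
    -- Exchanging `b` and `b'` in the list of `x` preserves the positions where `p` holds, so it
    -- turns deliveries whose first hit is `b` injectively into deliveries whose first hit is `b'`.
    -- All fibres of `F` thus have the same size.
    have hp : p ∘ Equiv.swap b b' = p := by
      funext c
      rw [Function.comp_apply, Equiv.swap_apply_def]
      split_ifs with h1 h2
      · rw [h1, hpb.2, hpb'.2]
      · rw [h2, hpb.2, hpb'.2]
      · rfl
    refine Finset.card_le_card_of_injOn
      (fun o => Function.update o x ((o x).map (Equiv.swap b b'))) ?_ ?_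
    · intro o ho
      have ho := Finset.mem_filter.1 ho
      refine Finset.mem_filter.2 ⟨mem_deliveries.2 fun y => ?_, ?_⟩
      · dsimp only
        rcases eq_or_ne y x with rfl | hy
        · rw [Function.update_self]
          exact orderings_map_swap hpb.1 hpb'.1 (mem_deliveries.1 ho.1 y)
        · rw [Function.update_of_ne hy]
          exact mem_deliveries.1 ho.1 y
      · have h1 := ho.2
        have h2 := hmaps o ho.1
        simp only [hF, Function.update_self, List.find?_map, hp] at h1 h2 ⊢
        rcases h : (o x).find? p with _ | c
        · obtain ⟨a, ha⟩ := hne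
          rw [hH, Finset.mem_filter] at ha
          exact absurd ha.2 (List.find?_eq_none.1 h a
            ((mem_of_mem_orderings (mem_deliveries.1 ho.1 x)).2 ha.1))
        · rw [h, Option.getD_some] at h1
          simp [h1]
    · intro o _ o' _ h
      funext y
      have hy := congrFun h y
      rcases eq_or_ne y x with rfl | hne
      · simp only [Function.update_self] at hy
        exact List.map_injective_iff.2 (Equiv.injective _) hy
      · simpa [Function.update_of_ne hne] using hy
  obtain ⟨b₀, hb₀⟩ := hne
  set c := ((deliveries msgs).filter fun o => F o = b₀).card
  have hc : ∀ b ∈ H, ((deliveries msgs).filter fun o => F o = b).card = c := fun b hb =>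
    le_antisymm (hle b hb b₀ hb₀) (hle b₀ hb₀ b hb)
  have hsum : ∀ ψ : Block ι → ℝ, ∑ o ∈ deliveries msgs, ψ (F o) = c * ∑ b ∈ H, ψ b := fun ψ => by
    rw [← Finset.sum_fiberwise_of_maps_to hmaps, Finset.mul_sum]
    refine Finset.sum_congr rfl fun b hb => ?_
    rw [Finset.sum_congr rfl fun o ho => by rw [(Finset.mem_filter.1 ho).2], Finset.sum_const,
      hc b hb, nsmul_eq_mul]
  -- With `ψ = 1` the fibre sum counts the deliveries; their number is positive, hence so is the
  -- common fibre size `c`, which can be cancelled.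
  have hcard := hsum fun _ => 1
  simp only [Finset.sum_const, nsmul_eq_mul, mul_one] at hcard
  have h0 : ((deliveries msgs).card : ℝ) ≠ 0 :=
    Nat.cast_ne_zero.2 (Finset.card_ne_zero.2 (deliveries_nonempty msgs))
  rw [hcard] at h0
  rw [Finset.expect_eq_sum_div_card, Finset.expect_eq_sum_div_card, hsum, hcard,
    mul_div_mul_left _ _ (left_ne_zero_of_mul h0)]

/-! ### Chains and the number of own blocks in them -/

section Blocks

variable {ι : Type*}

theorem Block.mem_chain_self {b : Block ι} (h : b ≠ .genesis) : b ∈ b.chain := by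
  cases b with
  | genesis => exact absurd rfl h
  | mk p c r x => simp [Block.chain]

theorem Block.height_le_of_mem_chain {b c : Block ι} (h : c ∈ b.chain) : c.height ≤ b.height := by
  induction b with
  | genesis => simp [Block.chain] at h
  | mk p i r x ih =>
    rw [Block.chain, List.mem_cons] at h
    rcases h with rfl | h
    · exact le_rfl
    · exact (ih h).trans (Nat.le_succ _)

theorem Block.length_chain (b : Block ι) : b.chain.length = b.height := by
  induction b with
  | genesis => rfl
  | mk p i r x ih => simp [Block.chain, Block.height, ih]

variable [DecidableEq ι]

/-- The number of blocks of party `i` in the chain that ends in `b`. -/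
def ownBlocks (i : ι) (b : Block ι) : ℕ := blocksOf b.chain i

theorem ownBlocks_mk (i : ι) (p : Block ι) (c : ι) (r x : ℕ) :
    ownBlocks i (.mk p c r x) = ownBlocks i p + if c = i then 1 else 0 := by
  by_cases h : c = i <;>
    simp [ownBlocks, blocksOf, Block.chain, Block.CreatedBy, h]

theorem ownBlocks_le_height (i : ι) (b : Block ι) : ownBlocks i b ≤ b.height := by
  rw [← b.length_chain]
  exact List.countP_le_length

theorem ownBlocks_le_of_mem_chain (i : ι) {b c : Block ι} (h : c ∈ b.chain) :
    ownBlocks i c ≤ ownBlocks i b := by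
  induction b with
  | genesis => simp [Block.chain] at h
  | mk p j r x ih =>
    rw [Block.chain, List.mem_cons] at h
    rcases h with rfl | h
    · exact le_rfl
    · rw [ownBlocks_mk]
      exact (ih h).trans (Nat.le_add_right _ _)

end Blocks

/-! ### Views, tips and newly created blocks -/

section Traces

variable {ι : Type*}

/-- The blocks received by a recipient (a party or the observer) in order of arrival. -/
def Trace.recv (τ : Trace ι) : Option ι → List (Block ι)
  | some i => (τ.records i).flatMap SlotRecord.received
  | none => τ.observed

/-- The longest block received by a recipient. -/
def Trace.tip (τ : Trace ι) (x : Option ι) : Block ι := longest (τ.recv x)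

theorem Trace.tip_mem (τ : Trace ι) (x : Option ι) :
    τ.tip x = .genesis ∨ τ.tip x ∈ τ.recv x := longest_mem _

variable [DecidableEq ι]

theorem Trace.mem_known {τ : Trace ι} {i : ι} {b : Block ι} :
    b ∈ τ.known i ↔ b = .genesis ∨ ∃ c, (c ∈ τ.recv (some i) ∨ c ∈ τ.created i) ∧ b ∈ c.chain := by
  simp only [Trace.known, Trace.recv, Finset.mem_insert, Finset.mem_biUnion, Finset.mem_union,
    List.mem_toFinset]

theorem Trace.tip_mem_known (τ : Trace ι) (i : ι) : τ.tip (some i) ∈ τ.known i := by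
  rw [Trace.mem_known]
  by_cases h : τ.tip (some i) = .genesis
  · exact Or.inl h
  · exact Or.inr ⟨_, Or.inl ((τ.tip_mem _).resolve_left h), Block.mem_chain_self h⟩

theorem mem_newBlocks {q : ℕ} {τ : Trace ι} {r : ℕ} {L : Finset ι} {i : ι} {a : Action ι}
    {b : Block ι} : b ∈ newBlocks q τ r L i a ↔
      i ∈ L ∧ ∃ x ∈ queriesOf q a, x.1 ∈ τ.known i ∧ Block.mk x.1 i r x.2 = b := by
  unfold newBlocks
  split_ifs with h
  · simp [h, and_assoc]
  · simp [h]

theorem newBlocks_of_notMem {q : ℕ} {τ : Trace ι} {r : ℕ} {L : Finset ι} {i : ι}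
    (a : Action ι) (h : i ∉ L) : newBlocks q τ r L i a = ∅ := if_neg h

variable [Fintype ι]

theorem recv_nextTrace (G : Params ι) (act : ι → List (SlotRecord ι) → Bool → Action ι) (r : ℕ)
    (τ : Trace ι) (L : Finset ι) (o : Option ι → List (Block ι)) (x : Option ι) :
    (nextTrace G act r τ L o).recv x = τ.recv x ++ o x := by
  cases x <;> simp [Trace.recv, nextTrace]

end Traces

/-! ### Sibling rules; honesty is the case of one sibling -/

section Rules

variable {ι : Type*} [DecidableEq ι]

/-- The rule of a party that makes `t` queries in every slot that it leads, all of which extend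
its longest chain, and diffuses the `t` new blocks. -/
def siblingRule (t : ℕ) (me : ι) (past : List (SlotRecord ι)) (isLeader : Bool) : Action ι :=
  if isLeader then
    ⟨(List.range t).map fun c => (longest (past.flatMap SlotRecord.received), c),
      (Finset.range t).image fun c =>
        .mk (longest (past.flatMap SlotRecord.received)) me past.length c⟩
  else ⟨[], ∅⟩

theorem honest_act (w : Fin ((honest ι).coins + 1)) (i : ι) :
    (honest ι).act w i = siblingRule 1 i := by
  funext past isLeader
  simp [honest, siblingRule]

/-- Party `P` follows the rule `s`, all other parties are honest. -/
def deviation (P : ι) (s : List (SlotRecord ι) → Bool → Action ι) :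
    ι → List (SlotRecord ι) → Bool → Action ι :=
  fun i => if i = P then s else siblingRule 1 i

theorem deviation_self (P : ι) (s : List (SlotRecord ι) → Bool → Action ι) :
    deviation P s P = s := if_pos rfl

theorem deviation_of_ne {P i : ι} (h : i ≠ P) (s : List (SlotRecord ι) → Bool → Action ι) :
    deviation P s i = siblingRule 1 i := if_neg h

end Rules

/-! ### Slots that start with equal heights everywhere -/

section Synced

variable {ι : Type*}

/-- Before slot `r` all recipients have a longest block of height `m`, and `P` has no secret
longer chain. -/
structure Synced (P : ι) (r m : ℕ) (τ : Trace ι) : Prop where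
  length_records : ∀ i, (τ.records i).length = r
  height_recv : ∀ x, ∀ b ∈ τ.recv x, b.height ≤ m
  height_tip : ∀ x, (τ.tip x).height = m
  height_created : ∀ b ∈ τ.created P, b.height ≤ m

/-- The block that an honest leader creates. -/
def honestBlock (τ : Trace ι) (r : ℕ) (i : ι) : Block ι := .mk (τ.tip (some i)) i r 0

theorem synced_init (P : ι) : Synced P 0 0 (Trace.init ι) where
  length_records _ := rfl
  height_recv x b hb := by cases x <;> simp [Trace.recv, Trace.init] at hb
  height_tip x := by cases x <;> rfl
  height_created b hb := by simp [Trace.init] at hb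

theorem honestBlock_injective (τ : Trace ι) (r : ℕ) : Function.Injective (honestBlock τ r) :=
  fun i j h => by
    simp only [honestBlock, Block.mk.injEq] at h
    exact h.2.1

variable {P : ι} {r m : ℕ} {τ : Trace ι}

theorem Synced.height_honestBlock (h : Synced P r m τ) (i : ι) :
    (honestBlock τ r i).height = m + 1 := by
  rw [honestBlock, Block.height, h.height_tip]

variable [DecidableEq ι]

theorem Synced.height_known (h : Synced P r m τ) {b : Block ι} (hb : b ∈ τ.known P) :
    b.height ≤ m := by
  rcases Trace.mem_known.1 hb with rfl | ⟨c, hc, hbc⟩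
  · exact Nat.zero_le _
  · refine (Block.height_le_of_mem_chain hbc).trans ?_
    rcases hc with hc | hc
    · exact h.height_recv _ c hc
    · exact h.height_created c hc

variable [Fintype ι]

variable {G : Params ι} {s : List (SlotRecord ι) → Bool → Action ι}

/-- The new blocks that party `P` diffuses and that are higher than `m`. -/
def rivalBlocks (G : Params ι) (P : ι) (s : List (SlotRecord ι) → Bool → Action ι) (r m : ℕ)
    (τ : Trace ι) (L : Finset ι) : Finset (Block ι) :=
  (newBlocks G.queryBound τ r L P (s (τ.records P) (decide (P ∈ L)))).filter fun b =>
    b ∈ (s (τ.records P) (decide (P ∈ L))).diffuse ∧ m < b.height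

/-- The honest leaders contribute exactly one block each: their single query fits into the query
bound, and the slot number they write is correct because the number of records is `r`. Only the
contribution of `P` remains unspecified. -/
theorem mem_slotMessages (h : Synced P r m τ) (hq : 1 ≤ G.queryBound) {L : Finset ι}
    {b : Block ι} : b ∈ slotMessages G (deviation P s) r τ L ↔
      (∃ i ∈ L.erase P, honestBlock τ r i = b) ∨
      (b ∈ (s (τ.records P) (decide (P ∈ L))).diffuse ∧ (b ∈ τ.known P ∨
        b ∈ newBlocks G.queryBound τ r L P (s (τ.records P) (decide (P ∈ L))))) := by
  have hhon : ∀ i ≠ P, b ∈ (deviation P s i (τ.records i) (decide (i ∈ L))).diffuse ∩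
      (τ.known i ∪ newBlocks G.queryBound τ r L i
        (deviation P s i (τ.records i) (decide (i ∈ L)))) ↔ i ∈ L ∧ honestBlock τ r i = b := by
    intro i hi
    rw [deviation_of_ne hi]
    by_cases hL : i ∈ L
    · have hmem : honestBlock τ r i ∈ newBlocks G.queryBound τ r L i
          (siblingRule 1 i (τ.records i) true) := by
        refine mem_newBlocks.2 ⟨hL, (τ.tip (some i), 0), ?_, τ.tip_mem_known i, rfl⟩
        obtain ⟨q, hq'⟩ : ∃ q, G.queryBound = q + 1 := ⟨G.queryBound - 1, by omega⟩
        simp [queriesOf, siblingRule, hq', Trace.tip, Trace.recv]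
      have hd : (siblingRule 1 i (τ.records i) true).diffuse = {honestBlock τ r i} := by
        simp [siblingRule, honestBlock, h.length_records i, Trace.tip, Trace.recv]
      simp only [hL, decide_true, hd, Finset.mem_inter, Finset.mem_singleton, Finset.mem_union,
        true_and]
      constructor
      · exact fun h => h.1.symm
      · rintro rfl
        exact ⟨rfl, Or.inr hmem⟩
    · simp [hL, siblingRule]
  simp only [slotMessages, Finset.mem_biUnion, Finset.mem_univ, true_and, Finset.mem_erase]
  constructor
  · rintro ⟨i, hi⟩
    by_cases hP : i = P
    · subst hP
      right
      simpa [deviation_self] using hi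
    · exact Or.inl ⟨i, ⟨hP, ((hhon i hP).1 hi).1⟩, ((hhon i hP).1 hi).2⟩
  · rintro (⟨i, ⟨hP, hL⟩, hb⟩ | hb)
    · exact ⟨i, (hhon i hP).2 ⟨hL, hb⟩⟩
    · exact ⟨P, by simpa [deviation_self] using hb⟩

theorem Synced.height_newBlocks (h : Synced P r m τ) {L : Finset ι} {a : Action ι} {b : Block ι}
    (hb : b ∈ newBlocks G.queryBound τ r L P a) : b.height ≤ m + 1 := by
  obtain ⟨_, x, _, hx, rfl⟩ := mem_newBlocks.1 hb
  exact Nat.succ_le_succ (h.height_known hx)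

theorem Synced.height_slotMessages (h : Synced P r m τ) (hq : 1 ≤ G.queryBound) {L : Finset ι}
    {b : Block ι} (hb : b ∈ slotMessages G (deviation P s) r τ L) : b.height ≤ m + 1 := by
  rcases (mem_slotMessages h hq).1 hb with ⟨i, _, rfl⟩ | ⟨_, hb | hb⟩
  · exact (h.height_honestBlock i).le
  · exact (h.height_known hb).trans (Nat.le_succ _)
  · exact h.height_newBlocks hb

/-- The messages of a slot that are longer than the longest chain before the slot. -/
theorem Synced.filter_slotMessages (h : Synced P r m τ) (hq : 1 ≤ G.queryBound) (L : Finset ι) :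
    ((slotMessages G (deviation P s) r τ L).filter fun b => decide (m < b.height)) =
      (L.erase P).image (honestBlock τ r) ∪ rivalBlocks G P s r m τ L := by
  ext b
  simp only [Finset.mem_filter, mem_slotMessages h hq, Finset.mem_union, Finset.mem_image,
    rivalBlocks, decide_eq_true_eq]
  constructor
  · rintro ⟨hb | ⟨hd, hb | hb⟩, hm⟩
    · exact Or.inl hb
    · exact absurd (h.height_known hb) (not_le.2 hm)
    · exact Or.inr ⟨hb, hd, hm⟩
  · rintro (⟨i, hi, rfl⟩ | ⟨hb, hd, hm⟩)
    · exact ⟨Or.inl ⟨i, hi, rfl⟩, by rw [h.height_honestBlock]; omega⟩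
    · exact ⟨Or.inr ⟨hd, Or.inr hb⟩, hm⟩

theorem Synced.tip_nextTrace (h : Synced P r m τ) (hq : 1 ≤ G.queryBound) {L : Finset ι}
    {o : Option ι → List (Block ι)}
    (ho : o ∈ deliveries (slotMessages G (deviation P s) r τ L)) (x : Option ι) :
    (nextTrace G (deviation P s) r τ L o).tip x =
      ((o x).find? fun b => decide (m < b.height)).getD (τ.tip x) := by
  have hx : (longest (τ.recv x)).height = m := h.height_tip x
  rw [Trace.tip, recv_nextTrace, longest_append, hx]
  · rfl
  · intro b hb
    rw [hx]
    exact h.height_slotMessages hq ((mem_of_mem_orderings (mem_deliveries.1 ho x)).1 hb)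

theorem disjoint_honestBlock_rivalBlocks (L : Finset ι) :
    Disjoint ((L.erase P).image (honestBlock τ r)) (rivalBlocks G P s r m τ L) := by
  rw [Finset.disjoint_left]
  intro b hb hb'
  obtain ⟨i, hi, rfl⟩ := Finset.mem_image.1 hb
  obtain ⟨_, x, _, _, hx⟩ := mem_newBlocks.1 (Finset.mem_filter.1 hb').1
  simp only [honestBlock, Block.mk.injEq] at hx
  exact (Finset.mem_erase.1 hi).1 hx.2.1.symm

/-- The number of candidates for the next block of the longest chain. -/
def candidates (G : Params ι) (P : ι) (s : List (SlotRecord ι) → Bool → Action ι) (r m : ℕ)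
    (τ : Trace ι) (L : Finset ι) : ℕ :=
  (L.erase P).card + (rivalBlocks G P s r m τ L).card

/-- The new longest block of each recipient is uniformly distributed among the candidates. -/
theorem Synced.expect_tip (h : Synced P r m τ) (hq : 1 ≤ G.queryBound) (L : Finset ι)
    (hL : candidates G P s r m τ L ≠ 0) (x : Option ι) (φ : Block ι → ℝ) :
    ((deliveries (slotMessages G (deviation P s) r τ L)).expect fun o =>
      φ ((nextTrace G (deviation P s) r τ L o).tip x)) =
    (∑ i ∈ L.erase P, φ (honestBlock τ r i) + ∑ b ∈ rivalBlocks G P s r m τ L, φ b) /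
      candidates G P s r m τ L := by
  rw [Finset.expect_congr rfl fun o ho => by rw [h.tip_nextTrace hq ho x]]
  have hcard : ((L.erase P).image (honestBlock τ r) ∪ rivalBlocks G P s r m τ L).card =
      candidates G P s r m τ L := by
    rw [Finset.card_union_of_disjoint (disjoint_honestBlock_rivalBlocks L),
      Finset.card_image_of_injective _ (honestBlock_injective τ r), candidates]
  rw [expect_deliveries_find, h.filter_slotMessages hq, Finset.expect_eq_sum_div_card, hcard,
    Finset.sum_union (disjoint_honestBlock_rivalBlocks L),
    Finset.sum_image (honestBlock_injective τ r).injOn]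
  rw [h.filter_slotMessages hq, ← Finset.card_pos, hcard]
  omega

theorem Synced.tip_nextTrace_of_no_candidates (h : Synced P r m τ) (hq : 1 ≤ G.queryBound)
    {L : Finset ι} (hL : candidates G P s r m τ L = 0) {o : Option ι → List (Block ι)}
    (ho : o ∈ deliveries (slotMessages G (deviation P s) r τ L)) (x : Option ι) :
    (nextTrace G (deviation P s) r τ L o).tip x = τ.tip x := by
  rw [h.tip_nextTrace hq ho]
  have : ((o x).find? fun b => decide (m < b.height)) = none := by
    rw [List.find?_eq_none]
    intro b hb hm
    have hb' : b ∈ (slotMessages G (deviation P s) r τ L).filter fun b => decide (m < b.height) :=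
      Finset.mem_filter.2 ⟨(mem_of_mem_orderings (mem_deliveries.1 ho x)).1 hb, hm⟩
    rw [h.filter_slotMessages hq] at hb'
    simp only [candidates, Nat.add_eq_zero_iff, Finset.card_eq_zero] at hL
    simp [hL.1, hL.2] at hb'
  rw [this, Option.getD_none]

/-- One candidate suffices to lift every recipient to height `m + 1`, because all recipients get the
same messages. A block that `P` withholds has height at most `m + 1`, so it gives no lead
afterwards, whatever the rule `s` is. -/
theorem Synced.nextTrace_of_candidates (h : Synced P r m τ) (hq : 1 ≤ G.queryBound)
    {L : Finset ι} (hL : candidates G P s r m τ L ≠ 0) {o : Option ι → List (Block ι)}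
    (ho : o ∈ deliveries (slotMessages G (deviation P s) r τ L)) :
    Synced P (r + 1) (m + 1) (nextTrace G (deviation P s) r τ L o) where
  length_records i := by simp [nextTrace, h.length_records i]
  height_recv x b hb := by
    rw [recv_nextTrace, List.mem_append] at hb
    rcases hb with hb | hb
    · exact (h.height_recv x b hb).trans (Nat.le_succ _)
    · exact h.height_slotMessages hq ((mem_of_mem_orderings (mem_deliveries.1 ho x)).1 hb)
  height_tip x := by
    rw [h.tip_nextTrace hq ho]
    have hne : (L.erase P).image (honestBlock τ r) ∪ rivalBlocks G P s r m τ L ≠ ∅ := by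
      intro h0
      rw [Finset.union_eq_empty, Finset.image_eq_empty] at h0
      exact hL (by simp [candidates, h0.1, h0.2])
    obtain ⟨b, hb⟩ := Finset.nonempty_iff_ne_empty.2 hne
    rw [← h.filter_slotMessages hq, Finset.mem_filter] at hb
    rcases hf : (o x).find? fun b => decide (m < b.height) with _ | c
    · exact absurd hb.2 (List.find?_eq_none.1 hf b
        ((mem_of_mem_orderings (mem_deliveries.1 ho x)).2 hb.1))
    · have h1 := h.height_slotMessages hq
        ((mem_of_mem_orderings (mem_deliveries.1 ho x)).1 (List.mem_of_find?_eq_some hf))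
      have h2 := List.find?_some hf
      simp only [decide_eq_true_eq] at h2
      rw [hf, Option.getD_some]
      omega
  height_created b hb := by
    rcases Finset.mem_union.1 hb with hb | hb
    · exact (h.height_created b hb).trans (Nat.le_succ _)
    · rw [deviation_self] at hb
      exact h.height_newBlocks hb

theorem candidates_of_notMem {L : Finset ι} (hP : P ∉ L) :
    candidates G P s r m τ L = L.card := by
  simp [candidates, rivalBlocks, newBlocks_of_notMem _ hP, Finset.erase_eq_of_notMem hP]

/-- Without leaders only old blocks can be diffused by `P`, and these have height at most `m`. The
remaining case, in which `P` leads alone and withholds its block, would break the invariant. -/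
theorem Synced.nextTrace_of_no_leaders (h : Synced P r m τ) (hq : 1 ≤ G.queryBound)
    {o : Option ι → List (Block ι)}
    (ho : o ∈ deliveries (slotMessages G (deviation P s) r τ ∅)) :
    Synced P (r + 1) m (nextTrace G (deviation P s) r τ ∅ o) where
  length_records i := by simp [nextTrace, h.length_records i]
  height_recv x b hb := by
    rw [recv_nextTrace, List.mem_append] at hb
    rcases hb with hb | hb
    · exact h.height_recv x b hb
    · rcases (mem_slotMessages h hq).1
        ((mem_of_mem_orderings (mem_deliveries.1 ho x)).1 hb) with ⟨i, hi, _⟩ | ⟨_, hb | hb⟩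
      · simp at hi
      · exact h.height_known hb
      · simp [mem_newBlocks] at hb
  height_tip x := by
    rw [h.tip_nextTrace_of_no_candidates hq (candidates_of_notMem (by simp)) ho, h.height_tip]
  height_created b hb := by
    rcases Finset.mem_union.1 hb with hb | hb
    · exact h.height_created b hb
    · simp [mem_newBlocks] at hb

end Synced

/-! ### Moments of the size of a random subset -/

section SubsetWeight

variable {ι : Type*} [DecidableEq ι]

/-- Probability that a random subset of `S`, which contains every `i ∈ S` independently with
probability `f i`, equals `A`. -/
noncomputable def subsetWeight (f : ι → ℝ) (S A : Finset ι) : ℝ :=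
  (∏ i ∈ A, f i) * ∏ i ∈ S \ A, (1 - f i)

theorem subsetWeight_insert_left (f : ι → ℝ) {S A : Finset ι} {a : ι} (ha : a ∉ S) (hA : A ⊆ S) :
    subsetWeight f (insert a S) A = (1 - f a) * subsetWeight f S A := by
  have haA : a ∉ A := fun h => ha (hA h)
  rw [subsetWeight, subsetWeight, Finset.insert_sdiff_of_notMem _ haA,
    Finset.prod_insert (by simp [ha])]
  ring

theorem subsetWeight_insert_insert (f : ι → ℝ) {S A : Finset ι} {a : ι} (ha : a ∉ S)
    (hA : A ⊆ S) : subsetWeight f (insert a S) (insert a A) = f a * subsetWeight f S A := by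
  have haA : a ∉ A := fun h => ha (hA h)
  rw [subsetWeight, subsetWeight, Finset.insert_sdiff_insert, Finset.sdiff_insert_of_notMem ha,
    Finset.prod_insert haA]
  ring

theorem sum_subsetWeight_insert (f : ι → ℝ) {S : Finset ι} {a : ι} (ha : a ∉ S)
    (g : Finset ι → ℝ) :
    ∑ A ∈ (insert a S).powerset, subsetWeight f (insert a S) A * g A =
      ∑ A ∈ S.powerset, subsetWeight f S A * ((1 - f a) * g A + f a * g (insert a A)) := by
  rw [Finset.sum_powerset_insert ha, ← Finset.sum_add_distrib]
  refine Finset.sum_congr rfl fun A hA => ?_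
  rw [subsetWeight_insert_left f ha (Finset.mem_powerset.1 hA),
    subsetWeight_insert_insert f ha (Finset.mem_powerset.1 hA)]
  ring

theorem sum_subsetWeight (f : ι → ℝ) (S : Finset ι) :
    ∑ A ∈ S.powerset, subsetWeight f S A = 1 := by
  induction S using Finset.induction_on with
  | empty => simp [subsetWeight]
  | insert a S ha ih =>
    have h := sum_subsetWeight_insert f ha fun _ => 1
    simp only [mul_one, sub_add_cancel] at h
    rw [h, ih]

theorem sum_subsetWeight_card (f : ι → ℝ) (S : Finset ι) :
    ∑ A ∈ S.powerset, subsetWeight f S A * (A.card : ℝ) = ∑ i ∈ S, f i := by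
  induction S using Finset.induction_on with
  | empty => simp [subsetWeight]
  | insert a S ha ih =>
    rw [sum_subsetWeight_insert f ha, Finset.sum_insert ha, ← ih]
    have h : ∀ A ∈ S.powerset, subsetWeight f S A *
        ((1 - f a) * (A.card : ℝ) + f a * ((insert a A).card : ℝ)) =
        f a * subsetWeight f S A + subsetWeight f S A * (A.card : ℝ) := fun A hA => by
      rw [Finset.card_insert_of_notMem fun h => ha (Finset.mem_powerset.1 hA h)]
      push_cast
      ring
    rw [Finset.sum_congr rfl h, Finset.sum_add_distrib, ← Finset.mul_sum, sum_subsetWeight, mul_one]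

/-- The variance of a sum of independent Bernoulli variables is at most its mean; the slack is the
sum of the squares `f i ^ 2`. -/
theorem sum_subsetWeight_card_sq_le (f : ι → ℝ) (S : Finset ι) :
    ∑ A ∈ S.powerset, subsetWeight f S A * (A.card : ℝ) ^ 2 ≤
      ∑ i ∈ S, f i + (∑ i ∈ S, f i) ^ 2 := by
  induction S using Finset.induction_on with
  | empty => simp [subsetWeight]
  | insert a S ha ih =>
    have h : ∀ A ∈ S.powerset, subsetWeight f S A *
        ((1 - f a) * (A.card : ℝ) ^ 2 + f a * ((insert a A).card : ℝ) ^ 2) =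
        subsetWeight f S A * (A.card : ℝ) ^ 2 + 2 * f a * (subsetWeight f S A * (A.card : ℝ)) +
          f a * subsetWeight f S A := fun A hA => by
      rw [Finset.card_insert_of_notMem fun h => ha (Finset.mem_powerset.1 hA h)]
      push_cast
      ring
    rw [sum_subsetWeight_insert f ha, Finset.sum_insert ha, Finset.sum_congr rfl h,
      Finset.sum_add_distrib, Finset.sum_add_distrib, ← Finset.mul_sum, ← Finset.mul_sum,
      sum_subsetWeight, sum_subsetWeight_card]
    nlinarith [sq_nonneg (f a)]

theorem subsetWeight_nonneg {f : ι → ℝ} {S A : Finset ι} (h0 : ∀ i, 0 ≤ f i) (h1 : ∀ i, f i ≤ 1) :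
    0 ≤ subsetWeight f S A :=
  mul_nonneg (Finset.prod_nonneg fun i _ => h0 i)
    (Finset.prod_nonneg fun i _ => sub_nonneg.2 (h1 i))

end SubsetWeight

/-! ### Leader election and the advantage of siblings -/

section Leaders

variable {ι : Type*} [Fintype ι]

theorem stake_nonneg (μ : stdSimplex ℝ ι) (i : ι) : 0 ≤ μ i := μ.2.1 i

theorem stake_le_one (μ : stdSimplex ℝ ι) (i : ι) : μ i ≤ 1 :=
  (Finset.single_le_sum (f := fun i => μ i) (fun j _ => μ.2.1 j) (Finset.mem_univ i)).trans_eq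
    μ.2.2

variable [DecidableEq ι]

/-- Expectations over the set of leaders, conditioned on whether `P` leads. -/
theorem sum_leaderWeight_mul (μ : stdSimplex ℝ ι) (P : ι) (g : Finset ι → ℝ) :
    ∑ L, leaderWeight μ L * g L = ∑ A ∈ (Finset.univ.erase P).powerset,
      subsetWeight μ (Finset.univ.erase P) A * ((1 - μ P) * g A + μ P * g (insert P A)) := by
  rw [← sum_subsetWeight_insert _ (Finset.notMem_erase P _),
    Finset.insert_erase (Finset.mem_univ P), Finset.powerset_univ]
  rfl

theorem sum_leaderWeight_mem (μ : stdSimplex ℝ ι) (P : ι) (g : Finset ι → ℝ) :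
    ∑ L, leaderWeight μ L * (if P ∈ L then g (L.erase P) else 0) =
      μ P * ∑ A ∈ (Finset.univ.erase P).powerset,
        subsetWeight μ (Finset.univ.erase P) A * g A := by
  rw [sum_leaderWeight_mul μ P, Finset.mul_sum]
  refine Finset.sum_congr rfl fun A hA => ?_
  have hPA : P ∉ A := fun h => Finset.notMem_erase P _ (Finset.mem_powerset.1 hA h)
  simp only [hPA, if_false, Finset.mem_insert_self, if_true, Finset.erase_insert hPA]
  ring

theorem sum_leaderWeight_mem_const (μ : stdSimplex ℝ ι) (P : ι) (c : ℝ) :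
    ∑ L, leaderWeight μ L * (if P ∈ L then c else 0) = μ P * c := by
  rw [sum_leaderWeight_mem μ P fun _ => c, ← Finset.sum_mul, sum_subsetWeight, one_mul]

/-- The advantage of `t` blocks over one in a slot with `k` competitors, up to a factor. -/
theorem advantage_ge (t k : ℕ) (ht : 2 ≤ t) :
    (if 2 ≤ k then 1 else 0) + (if k = 1 then 1 / 2 else 0) + ((k : ℝ) * (2 - k)) / 2 ≤
      2 * k * (t + 1) / ((t + k) * (k + 1)) := by
  have ht' : (2 : ℝ) ≤ t := by exact_mod_cast ht
  -- Equality holds for `k = 0` and `k = 1`; the case `k = 2` amounts to `2 ≤ t`; for `k ≥ 3` the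
  -- left side is already negative. The quadratic term, whose mean is nonnegative, pays for the
  -- shortfall at large `k`.
  rcases k with _ | _ | _ | k
  · simp
  · norm_num
    rw [le_div_iff₀ (by positivity)]
    linarith
  · norm_num
    rw [le_div_iff₀ (by positivity)]
    nlinarith
  · have h : 0 ≤ 2 * ((k + 3 : ℕ) : ℝ) * (t + 1) / ((t + (k + 3 : ℕ)) * ((k + 3 : ℕ) + 1)) := by
      positivity
    refine le_trans ?_ h
    rw [if_pos (by omega), if_neg (by omega)]
    push_cast
    nlinarith [(k.cast_nonneg : (0 : ℝ) ≤ k)]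

theorem multiLeaderProb_le (μ : stdSimplex ℝ ι) (P : ι) (hP : μ P < 1 / 2) (t : ℕ) (ht : 2 ≤ t) :
    multiLeaderProb μ ≤ ∑ A ∈ (Finset.univ.erase P).powerset,
      subsetWeight μ (Finset.univ.erase P) A *
        (2 * A.card * (t + 1) / ((t + A.card) * (A.card + 1))) := by
  set S := Finset.univ.erase P
  have h0 := stake_nonneg μ
  have h1 := stake_le_one μ
  have hm : multiLeaderProb μ = ∑ L, leaderWeight μ L * (if 2 ≤ L.card then 1 else 0) := by
    simp [multiLeaderProb, Finset.sum_filter]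
  have hsum : ∑ i ∈ S, μ i = 1 - μ P := by
    have h := Finset.add_sum_erase Finset.univ (fun i => μ i) (Finset.mem_univ P)
    have h' : ∑ i, μ i = 1 := μ.2.2
    linarith
  -- With mean `E = 1 - μ P` of the number of competitors, `2 * E` minus the second moment is at
  -- least `E - E ^ 2`, which is nonnegative because `E` lies in `[0, 1]`.
  have hpos : 0 ≤ ∑ A ∈ S.powerset, subsetWeight μ S A * (((A.card : ℝ) * (2 - A.card)) / 2) := by
    have h := sum_subsetWeight_card_sq_le μ S
    have h' : ∑ A ∈ S.powerset, subsetWeight μ S A * (((A.card : ℝ) * (2 - A.card)) / 2) =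
        ∑ A ∈ S.powerset, subsetWeight μ S A * (A.card : ℝ) -
          (∑ A ∈ S.powerset, subsetWeight μ S A * (A.card : ℝ) ^ 2) / 2 := by
      rw [Finset.sum_div, ← Finset.sum_sub_distrib]
      exact Finset.sum_congr rfl fun A _ => by ring
    rw [h', sum_subsetWeight_card, hsum]
    rw [hsum] at h
    nlinarith [h0 P, h1 P]
  rw [hm, sum_leaderWeight_mul μ P]
  -- Two competitors already make multiple leaders; with exactly one competitor `P` has to lead as
  -- well, which has probability `μ P < 1 / 2`.
  calc _ ≤ ∑ A ∈ S.powerset, subsetWeight μ S A *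
        ((if 2 ≤ A.card then 1 else 0) + (if A.card = 1 then 1 / 2 else 0)) := by
        refine Finset.sum_le_sum fun A hA => mul_le_mul_of_nonneg_left ?_
          (subsetWeight_nonneg h0 h1)
        have hPA : P ∉ A := fun h => Finset.notMem_erase P _ (Finset.mem_powerset.1 hA h)
        rw [Finset.card_insert_of_notMem hPA]
        have := h0 P
        split_ifs <;> first | omega | linarith
    _ ≤ ∑ A ∈ S.powerset, subsetWeight μ S A *
        ((if 2 ≤ A.card then 1 else 0) + (if A.card = 1 then 1 / 2 else 0)) +
        ∑ A ∈ S.powerset, subsetWeight μ S A * (((A.card : ℝ) * (2 - A.card)) / 2) := by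
        linarith
    _ ≤ _ := by
        rw [← Finset.sum_add_distrib]
        refine Finset.sum_le_sum fun A _ => ?_
        rw [← mul_add]
        exact mul_le_mul_of_nonneg_left (advantage_ge t A.card ht) (subsetWeight_nonneg h0 h1)

/-- The expected number of blocks (at most one) that `P` contributes to the longest chain in a
slot in which it diffuses `t` sibling blocks whenever it leads. -/
noncomputable def siblingGain (μ : stdSimplex ℝ ι) (P : ι) (t : ℕ) : ℝ :=
  ∑ L, leaderWeight μ L * (if P ∈ L then (t : ℝ) / (t + (L.erase P).card) else 0)

/-- What `P` gains in a slot from `t` sibling blocks instead of one. -/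
theorem siblingGain_sub_ge (μ : stdSimplex ℝ ι) (P : ι) (hP : μ P < 1 / 2) (t : ℕ) (ht : 2 ≤ t) :
    μ P * (((t : ℝ) - 1) / (2 * (t + 1)) * multiLeaderProb μ) ≤
      siblingGain μ P t - siblingGain μ P 1 := by
  have ht' : (2 : ℝ) ≤ t := by exact_mod_cast ht
  rw [siblingGain, siblingGain,
    sum_leaderWeight_mem μ P fun A => (t : ℝ) / (t + A.card),
    sum_leaderWeight_mem μ P fun A => ((1 : ℕ) : ℝ) / ((1 : ℕ) + A.card), ← mul_sub,
    ← Finset.sum_sub_distrib]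
  refine mul_le_mul_of_nonneg_left ?_ (stake_nonneg μ P)
  -- The factor `(t - 1) / (2 * (t + 1))` turns the summand of `multiLeaderProb_le` into exactly `t
  -- / (t + k) - 1 / (1 + k)`, where `k` is the number of competitors.
  refine (mul_le_mul_of_nonneg_left (multiLeaderProb_le μ P hP t ht)
    (div_nonneg (by linarith) (by linarith))).trans_eq ?_
  rw [Finset.mul_sum]
  refine Finset.sum_congr rfl fun A _ => ?_
  have hA : (0 : ℝ) ≤ A.card := Nat.cast_nonneg _
  have h1 : (t : ℝ) + A.card ≠ 0 := by linarith
  have h2 : (A.card : ℝ) + 1 ≠ 0 := by linarith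
  have h3 : (t : ℝ) + 1 ≠ 0 := by linarith
  have h4 : (1 : ℝ) + A.card ≠ 0 := by linarith
  push_cast
  field_simp
  ring

/-- Needed for the comparison with a party that makes no query at all: siblings must also beat a
gain of `0`. The bound discards a factor `k / (k + 1)`, where `k` is the number of competitors. -/
theorem siblingGain_ge (μ : stdSimplex ℝ ι) (P : ι) (hP : μ P < 1 / 2) (t : ℕ) (ht : 2 ≤ t) :
    μ P * ((t : ℝ) / (2 * (t + 1)) * multiLeaderProb μ) ≤ siblingGain μ P t := by
  have ht' : (2 : ℝ) ≤ t := by exact_mod_cast ht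
  rw [siblingGain, sum_leaderWeight_mem μ P fun A => (t : ℝ) / (t + A.card)]
  refine mul_le_mul_of_nonneg_left ?_ (stake_nonneg μ P)
  refine (mul_le_mul_of_nonneg_left (multiLeaderProb_le μ P hP t ht)
    (div_nonneg (by linarith) (by linarith))).trans ?_
  rw [Finset.mul_sum]
  refine Finset.sum_le_sum fun A _ => ?_
  have hA : (0 : ℝ) ≤ A.card := Nat.cast_nonneg _
  have h1 : 0 < (t : ℝ) + A.card := by linarith
  have h2 : 0 < (A.card : ℝ) + 1 := by linarith
  have h3 : 0 < (t : ℝ) + 1 := by linarith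
  have hw := subsetWeight_nonneg (S := Finset.univ.erase P) (A := A) (stake_nonneg μ)
    (stake_le_one μ)
  have h5 : (t : ℝ) / (2 * (t + 1)) * (2 * A.card * (t + 1) / ((t + A.card) * (A.card + 1))) ≤
      t / (t + A.card) := by
    have : (t : ℝ) / (2 * (t + 1)) * (2 * A.card * (t + 1) / ((t + A.card) * (A.card + 1))) =
        t / (t + A.card) * (A.card / (A.card + 1)) := by
      field_simp
    rw [this]
    refine mul_le_of_le_one_right (by positivity) ?_
    rw [div_le_one h2]
    linarith
  calc _ = subsetWeight μ (Finset.univ.erase P) A * ((t : ℝ) / (2 * (t + 1)) *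
        (2 * A.card * (t + 1) / ((t + A.card) * (A.card + 1)))) := by ring
    _ ≤ _ := mul_le_mul_of_nonneg_left h5 hw

theorem siblingGain_of_stake_eq_zero (μ : stdSimplex ℝ ι) (P : ι) (hP : μ P = 0) (t : ℕ) :
    siblingGain μ P t = 0 := by
  rw [siblingGain, sum_leaderWeight_mem μ P fun A => (t : ℝ) / (t + A.card), hP, zero_mul]

theorem notMem_of_stake_eq_zero {μ : stdSimplex ℝ ι} {P : ι} (hP : μ P = 0) {L : Finset ι}
    (hL : leaderWeight μ L ≠ 0) : P ∉ L := fun h =>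
  hL (by rw [leaderWeight, Finset.prod_eq_zero h hP, zero_mul])

theorem leaderWeight_pos {μ : stdSimplex ℝ ι} (h1 : ∀ i, μ i < 1 / 2) {L : Finset ι}
    (hL : ∀ i ∈ L, 0 < μ i) : 0 < leaderWeight μ L :=
  mul_pos (Finset.prod_pos hL) (Finset.prod_pos fun i _ => by linarith [h1 i])

end Leaders

/-! ### Expected blocks and queries under sibling rules -/

section Siblings

variable {ι : Type*} [Fintype ι] [DecidableEq ι] {G : Params ι} {P : ι}
  {s : List (SlotRecord ι) → Bool → Action ι} {r m t : ℕ} {τ : Trace ι}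

/-- The number of blocks of `P` in the longest chain received by `x`. -/
noncomputable def ownTip (P : ι) (x : Option ι) (τ : Trace ι) : ℝ := ownBlocks P (τ.tip x)

theorem ownBlocks_honestBlock {ι : Type*} [DecidableEq ι] {P i : ι} (hi : i ≠ P)
    (τ : Trace ι) (r : ℕ) :
    ownBlocks P (honestBlock τ r i) = ownBlocks P (τ.tip (some i)) := by
  rw [honestBlock, ownBlocks_mk, if_neg hi, add_zero]

theorem rivalBlocks_of_notMem {L : Finset ι} (hP : P ∉ L) : rivalBlocks G P s r m τ L = ∅ := by
  simp [rivalBlocks, newBlocks_of_notMem _ hP]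

theorem Synced.rivalBlocks_siblingRule (h : Synced P r m τ) (ht : t ≤ G.queryBound)
    {L : Finset ι} (hP : P ∈ L) : rivalBlocks G P (siblingRule t P) r m τ L =
      (Finset.range t).image fun c => Block.mk (τ.tip (some P)) P r c := by
  have htip : longest ((τ.records P).flatMap SlotRecord.received) = τ.tip (some P) := rfl
  ext b
  simp only [rivalBlocks, Finset.mem_filter, mem_newBlocks, hP, decide_true, siblingRule, htip,
    h.length_records P, if_true, queriesOf, true_and, Finset.mem_image, Finset.mem_range]
  constructor
  · exact fun hb => hb.2.1
  · rintro ⟨c, hc, rfl⟩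
    refine ⟨⟨(τ.tip (some P), c), ?_, τ.tip_mem_known P, rfl⟩, ⟨c, hc, rfl⟩, ?_⟩
    · rw [List.take_of_length_le (by simpa using ht)]
      simpa using hc
    · rw [Block.height, h.height_tip]
      omega

theorem card_siblings {ι : Type*} [DecidableEq ι] (p : Block ι) (P : ι) (r t : ℕ) :
    ((Finset.range t).image fun c => Block.mk p P r c).card = t := by
  rw [Finset.card_image_of_injective, Finset.card_range]
  intro c c' h
  simp only [Block.mk.injEq] at h
  exact h.2.2.2

theorem Synced.card_rivalBlocks (h : Synced P r m τ) (ht : t ≤ G.queryBound) {L : Finset ι}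
    (hs : P ∈ L → s = siblingRule t P) :
    (rivalBlocks G P s r m τ L).card = if P ∈ L then t else 0 := by
  split_ifs with hP
  · rw [hs hP, h.rivalBlocks_siblingRule ht hP, card_siblings]
  · rw [rivalBlocks_of_notMem hP, Finset.card_empty]

theorem Synced.sum_rivalBlocks (h : Synced P r m τ) (ht : t ≤ G.queryBound) {L : Finset ι}
    (hs : P ∈ L → s = siblingRule t P) :
    ∑ b ∈ rivalBlocks G P s r m τ L, (ownBlocks P b : ℝ) =
      (if P ∈ L then (t : ℝ) else 0) * (ownTip P (some P) τ + 1) := by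
  split_ifs with hP
  · rw [hs hP, h.rivalBlocks_siblingRule ht hP, Finset.sum_congr rfl (g := fun _ =>
      ownTip P (some P) τ + 1), Finset.sum_const, card_siblings, nsmul_eq_mul]
    intro b hb
    obtain ⟨c, _, rfl⟩ := Finset.mem_image.1 hb
    rw [ownBlocks_mk, if_pos rfl, ownTip]
    push_cast
    rfl
  · rw [rivalBlocks_of_notMem hP, Finset.sum_empty, zero_mul]

theorem Synced.candidates_eq_zero (h : Synced P r m τ) (ht1 : 1 ≤ t) (ht : t ≤ G.queryBound)
    {L : Finset ι} (hs : P ∈ L → s = siblingRule t P) :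
    candidates G P s r m τ L = 0 ↔ L = ∅ := by
  rw [candidates, h.card_rivalBlocks ht hs]
  split_ifs with hP
  · constructor
    · omega
    · rintro rfl
      simp at hP
  · rw [Finset.erase_eq_of_notMem hP, add_zero, Finset.card_eq_zero]

/-- Siblings are always diffused, so as soon as somebody leads there is a candidate. The rule `s` is
constrained only if `P` leads; hence this also covers an arbitrary `s` in slots that `P` does not
lead. -/
theorem Synced.exists_synced_nextTrace (h : Synced P r m τ) (ht1 : 1 ≤ t)
    (ht : t ≤ G.queryBound) {L : Finset ι} (hs : P ∈ L → s = siblingRule t P)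
    {o : Option ι → List (Block ι)}
    (ho : o ∈ deliveries (slotMessages G (deviation P s) r τ L)) :
    ∃ m', Synced P (r + 1) m' (nextTrace G (deviation P s) r τ L o) := by
  by_cases hc : candidates G P s r m τ L = 0
  · obtain rfl := (h.candidates_eq_zero ht1 ht hs).1 hc
    exact ⟨m, h.nextTrace_of_no_leaders (ht1.trans ht) ho⟩
  · exact ⟨m + 1, h.nextTrace_of_candidates (ht1.trans ht) hc ho⟩

/-- After a slot with leaders `L`, the expected number of blocks of `P` in the longest chain of `x`
is a convex combination of these numbers before the slot, plus the probability that a block of `P`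
from this slot is chosen. -/
theorem exists_expect_ownTip (G : Params ι) (P : ι) (r : ℕ) (ht1 : 1 ≤ t) (ht : t ≤ G.queryBound)
    (L : Finset ι) (x : Option ι) :
    ∃ d : Option ι → ℝ, (∀ y, 0 ≤ d y) ∧ ∑ y, d y = 1 ∧
      ∀ s τ m, Synced P r m τ → (P ∈ L → s = siblingRule t P) →
        ((deliveries (slotMessages G (deviation P s) r τ L)).expect fun o =>
          ownTip P x (nextTrace G (deviation P s) r τ L o)) =
        ∑ y, d y * ownTip P y τ +
          if P ∈ L then (t : ℝ) / (t + (L.erase P).card) else 0 := by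
  rcases eq_or_ne L ∅ with rfl | hL
  · refine ⟨Pi.single x 1, fun y => ?_, by simp, fun s τ m h hs => ?_⟩
    · rw [Pi.single_apply]
      split_ifs <;> norm_num
    · rw [Finset.expect_congr rfl fun o ho => by
        rw [ownTip, h.tip_nextTrace_of_no_candidates (ht1.trans ht)
          (candidates_of_notMem (Finset.notMem_empty P)) ho],
        Finset.expect_const (deliveries_nonempty _)]
      simp [Pi.single_apply, ownTip]
  · set k : ℝ := if P ∈ L then (t : ℝ) else 0 with hk
    have hk0 : 0 ≤ k := by
      rw [hk]
      split_ifs <;> positivity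
    set N : ℝ := (L.erase P).card + k with hN
    have hNpos : 0 < N := by
      by_cases hP : P ∈ L
      · have : (1 : ℝ) ≤ k := by
          rw [hk, if_pos hP]
          exact_mod_cast ht1
        exact add_pos_of_nonneg_of_pos (Nat.cast_nonneg _) (one_pos.trans_le this)
      · refine add_pos_of_pos_of_nonneg (Nat.cast_pos.2 ?_) hk0
        rw [Finset.erase_eq_of_notMem hP, Finset.card_pos]
        exact Finset.nonempty_iff_ne_empty.2 hL
    -- `d y` is the probability that the winning block extends the tip of `y`: one of `N` candidates
    -- for each other leader, `k` of them for `P`, and none for the observer.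
    refine ⟨fun y => y.elim 0 fun i =>
      ((if i ∈ L.erase P then 1 else 0) + if i = P then k else 0) / N, ?_, ?_, ?_⟩
    · rintro (_ | i)
      · exact le_rfl
      · refine div_nonneg (add_nonneg ?_ ?_) hNpos.le
        · split_ifs <;> norm_num
        · split_ifs
          exacts [hk0, le_rfl]
    · rw [Fintype.sum_option]
      change 0 + ∑ i, ((if i ∈ L.erase P then 1 else 0) + if i = P then k else 0) / N = 1
      rw [zero_add, ← Finset.sum_div, Finset.sum_add_distrib, Finset.sum_ite_mem,
        Finset.sum_ite_eq', if_pos (Finset.mem_univ P), Finset.univ_inter, Finset.sum_const,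
        nsmul_eq_mul, mul_one]
      exact div_self hNpos.ne'
    · intro s τ m h hs
      have hcand : (candidates G P s r m τ L : ℝ) = N := by
        rw [candidates, h.card_rivalBlocks ht hs, hN, hk]
        push_cast
        rfl
      have hc0 : candidates G P s r m τ L ≠ 0 := fun h0 =>
        hL ((h.candidates_eq_zero ht1 ht hs).1 h0)
      have h1 := h.expect_tip (s := s) (ht1.trans ht) L hc0 x fun b => (ownBlocks P b : ℝ)
      have h2 : ∑ i ∈ L.erase P, (ownBlocks P (honestBlock τ r i) : ℝ) =
          ∑ i ∈ L.erase P, ownTip P (some i) τ :=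
        Finset.sum_congr rfl fun i hi => by
          rw [ownBlocks_honestBlock (Finset.ne_of_mem_erase hi), ownTip]
      rw [h.sum_rivalBlocks ht hs, hcand, h2, ← hk] at h1
      have h3 : (if P ∈ L then (t : ℝ) / (t + (L.erase P).card) else 0) = k / N := by
        rw [hN, hk]
        split_ifs
        · rw [add_comm]
        · simp
      simp only [ownTip] at h1 h3 ⊢
      rw [h1, h3, Fintype.sum_option]
      simp only [Option.elim, zero_mul, zero_add, div_mul_eq_mul_div, ← Finset.sum_div, add_mul,
        Finset.sum_add_distrib, ite_mul, one_mul, Finset.sum_ite_mem, Finset.sum_ite_eq',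
        Finset.mem_univ, if_true, Finset.univ_inter]
      rw [← add_div]
      ring

/-- The expected number of blocks of `P` in the longest chain of `x`, if in the slots considered
`P` either makes sibling blocks or has no stake. -/
theorem exists_value_ownTip (G : Params ι) (P : ι) (s : List (SlotRecord ι) → Bool → Action ι)
    (ht1 : 1 ≤ t) (ht : t ≤ G.queryBound) (r n : ℕ)
    (hs : ∀ k, r ≤ k → k < r + n → ∀ L, slotWeight G k L ≠ 0 → P ∈ L → s = siblingRule t P)
    (x : Option ι) :
    ∃ c : Option ι → ℝ, (∀ y, 0 ≤ c y) ∧ ∑ y, c y = 1 ∧ ∀ τ m, Synced P r m τ →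
      value G (deviation P s) r n (ownTip P x) τ = ∑ y, c y * ownTip P y τ +
        ∑ j ∈ Finset.range n, siblingGain (G.stake ((r + j) / G.slotsPerEpoch)) P t := by
  induction n generalizing r with
  | zero =>
    refine ⟨Pi.single x 1, fun y => ?_, by simp, fun τ m _ => by simp [Pi.single_apply, value]⟩
    rw [Pi.single_apply]
    split_ifs <;> norm_num
  | succ n ih =>
    obtain ⟨c, hc0, hc1, hc⟩ := ih (r + 1) fun k h1 h2 => hs k (by omega) (by omega)
    choose d hd0 hd1 hd using fun L y => exists_expect_ownTip G P r ht1 ht L y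
    set A := ∑ j ∈ Finset.range n, siblingGain (G.stake ((r + 1 + j) / G.slotsPerEpoch)) P t
      with hA
    -- The weights compose like transition matrices. This is possible because neither `c` nor `d`
    -- depends on the trace; by linearity only the law of each single tip matters, not the joint law
    -- of the tips.
    refine ⟨fun z => ∑ L, slotWeight G r L * ∑ y, c y * d L y z, fun z => ?_, ?_, ?_⟩
    · exact Finset.sum_nonneg fun L _ => mul_nonneg (slotWeight_nonneg G r L)
        (Finset.sum_nonneg fun y _ => mul_nonneg (hc0 y) (hd0 L y z))
    · rw [Finset.sum_comm, ← sum_slotWeight G r]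
      refine Finset.sum_congr rfl fun L _ => ?_
      rw [← Finset.mul_sum, Finset.sum_comm]
      simp only [← Finset.mul_sum, hd1, mul_one, hc1]
    · intro τ m h
      have key : ∀ L, slotWeight G r L * ((deliveries (slotMessages G (deviation P s) r τ L)).expect
          fun o => value G (deviation P s) (r + 1) n (ownTip P x)
            (nextTrace G (deviation P s) r τ L o)) =
          ∑ z, slotWeight G r L * (∑ y, c y * d L y z) * ownTip P z τ +
            slotWeight G r L * (if P ∈ L then (t : ℝ) / (t + (L.erase P).card) else 0) +
            slotWeight G r L * A := by
        intro L
        rcases eq_or_ne (slotWeight G r L) 0 with h0 | h0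
        · simp [h0]
        have hsL := hs r le_rfl (by omega) L h0
        rw [Finset.expect_congr rfl fun o ho => by
          obtain ⟨m', hm'⟩ := h.exists_synced_nextTrace ht1 ht hsL ho
          rw [hc _ m' hm'], Finset.expect_add_distrib, Finset.expect_const (deliveries_nonempty _),
          Finset.expect_sum_comm]
        simp only [← Finset.mul_expect, hd L _ s τ m h hsL, mul_add, Finset.sum_add_distrib]
        rw [← Finset.sum_mul, hc1, one_mul]
        congr 2
        simp only [mul_assoc, ← Finset.mul_sum]
        congr 1
        simp only [Finset.mul_sum, Finset.sum_mul, mul_assoc]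
        exact Finset.sum_comm
      rw [value, slotMean, Finset.sum_congr rfl fun L _ => key L, Finset.sum_add_distrib,
        Finset.sum_add_distrib, ← Finset.sum_mul, sum_slotWeight, one_mul, Finset.sum_comm,
        Finset.sum_range_succ']
      simp only [← Finset.sum_mul, add_zero]
      rw [add_assoc, add_comm (∑ L, _) A, hA]
      congr 2
      exact Finset.sum_congr rfl fun j _ => by rw [show r + 1 + j = r + (j + 1) by omega]

/-- The expected number of queries of a party that makes sibling blocks. -/
theorem value_queries_siblingRule (ht : t ≤ G.queryBound) (r n : ℕ) (τ : Trace ι) :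
    value G (deviation P (siblingRule t P)) r n (fun τ => (τ.queries P : ℝ)) τ =
      τ.queries P + ∑ j ∈ Finset.range n, G.stake ((r + j) / G.slotsPerEpoch) P * t := by
  induction n generalizing r τ with
  | zero => simp [value]
  | succ n ih =>
    have hfun : value G (deviation P (siblingRule t P)) (r + 1) n (fun τ => (τ.queries P : ℝ)) =
        fun τ => τ.queries P +
          ∑ j ∈ Finset.range n, G.stake ((r + 1 + j) / G.slotsPerEpoch) P * t :=
      funext fun τ => ih (r + 1) τ
    have hL : ∀ L o, ((nextTrace G (deviation P (siblingRule t P)) r τ L o).queries P : ℝ) =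
        τ.queries P + if P ∈ L then (t : ℝ) else 0 := fun L o => by
      have : (queriesOf G.queryBound (siblingRule t P (τ.records P) (decide (P ∈ L)))).length =
          if P ∈ L then t else 0 := by
        by_cases hP : P ∈ L <;> simp [queriesOf, siblingRule, hP, ht]
      simp only [nextTrace, deviation_self, this]
      push_cast
      rfl
    have h1 : slotMean G (deviation P (siblingRule t P)) r (fun τ => (τ.queries P : ℝ)) τ =
        τ.queries P + G.stake (r / G.slotsPerEpoch) P * t := by
      simp only [slotMean, hL, Finset.expect_const (deliveries_nonempty _), mul_add,
        Finset.sum_add_distrib, ← Finset.sum_mul, slotWeight, sum_leaderWeight, one_mul]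
      rw [sum_leaderWeight_mem_const]
    rw [value, hfun, slotMean_add, slotMean_const, h1, Finset.sum_range_succ']
    simp only [add_zero]
    rw [add_assoc, add_comm (G.stake _ P * _)]
    congr 2
    exact Finset.sum_congr rfl fun j _ => by rw [show r + 1 + j = r + (j + 1) by omega]

/-- The profit of party `P`. -/
noncomputable def profit (R C : ℝ) (P : ι) (τ : Trace ι) : ℝ :=
  ownTip P none τ * R - τ.queries P * C

theorem value_profit (act : ι → List (SlotRecord ι) → Bool → Action ι) (R C : ℝ) (r n : ℕ)
    (τ : Trace ι) : value G act r n (profit R C P) τ =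
      value G act r n (ownTip P none) τ * R -
        value G act r n (fun τ => (τ.queries P : ℝ)) τ * C := by
  have : profit R C P = fun τ => R * ownTip P none τ - C * τ.queries P := by
    funext τ
    rw [profit]
    ring
  rw [this, value_sub_fun, value_const_mul, value_const_mul]
  ring

end Siblings

/-! ### Existence of a best response -/

section Bounded

/-- An average over at most `k` points with values in `F` is determined by the size of the index set
and by how often each value of `F` is taken. This bounds the averages although `β` may be infinite.
-/
theorem finite_expect_values {β : Type*} {F : Set ℝ} (hF : F.Finite) (k : ℕ) :
    {y : ℝ | ∃ S : Finset β, S.card ≤ k ∧ ∃ v : β → ℝ, (∀ o ∈ S, v o ∈ F) ∧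
      y = S.expect v}.Finite := by
  classical
  lift F to Finset ℝ using hF
  refine (Set.finite_range fun c : (F → Fin (k + 1)) × Fin (k + 1) =>
    (∑ y : F, ((c.1 y : ℕ) : ℝ) * y) / ((c.2 : ℕ) : ℝ)).subset ?_
  rintro y ⟨S, hS, v, hv, rfl⟩
  refine ⟨(fun y => ⟨(S.filter fun o => v o = y).card,
    Nat.lt_succ_of_le ((Finset.card_filter_le _ _).trans hS)⟩, ⟨S.card, Nat.lt_succ_of_le hS⟩), ?_⟩
  rw [Finset.expect_eq_sum_div_card]
  refine congrArg (· / (S.card : ℝ)) ?_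
  have hsum : ∑ y : F, ((S.filter fun o => v o = y).card : ℝ) * y =
      ∑ y ∈ F, ((S.filter fun o => v o = y).card : ℝ) * y :=
    Finset.sum_coe_sort F fun y => ((S.filter fun o => v o = y).card : ℝ) * y
  rw [← Finset.sum_fiberwise_of_maps_to (t := F) (g := v) (by simpa using hv) v]
  refine hsum.trans (Finset.sum_congr rfl fun y _ => ?_)
  rw [Finset.sum_congr rfl fun o ho => (Finset.mem_filter.1 ho).2, Finset.sum_const, nsmul_eq_mul]

variable {ι : Type*} [Fintype ι] [DecidableEq ι]

/-- Genesis and all blocks created so far. -/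
def Trace.blocks (τ : Trace ι) : Finset (Block ι) :=
  insert .genesis (Finset.univ.biUnion τ.created)

/-- Bounds for the traces before slot `r` that hold for arbitrary strategies. -/
structure Bounded (G : Params ι) (r : ℕ) (τ : Trace ι) : Prop where
  recv_mem : ∀ x, ∀ b ∈ τ.recv x, b ∈ τ.blocks
  chain_mem : ∀ b ∈ τ.blocks, ∀ c ∈ b.chain, c ∈ τ.blocks
  card_le : τ.blocks.card ≤ 1 + r * (Fintype.card ι * G.queryBound)
  height_le : ∀ b ∈ τ.blocks, b.height ≤ r
  queries_le : ∀ i, τ.queries i ≤ r * G.queryBound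

variable {G : Params ι} {act : ι → List (SlotRecord ι) → Bool → Action ι} {r : ℕ} {τ : Trace ι}

theorem bounded_init (G : Params ι) : Bounded G 0 (Trace.init ι) where
  recv_mem x b hb := by cases x <;> simp [Trace.recv, Trace.init] at hb
  chain_mem b hb c hc := by
    simp only [Trace.blocks, Trace.init, Finset.mem_insert, Finset.mem_biUnion,
      Finset.notMem_empty, and_false, exists_false, or_false] at hb
    subst hb
    simp [Block.chain] at hc
  card_le := by
    have : (Finset.univ.biUnion (Trace.init ι).created) = ∅ := by
      ext b
      simp [Trace.init]
    simp [Trace.blocks, this]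
  height_le b hb := by
    simp only [Trace.blocks, Trace.init, Finset.mem_insert, Finset.mem_biUnion,
      Finset.notMem_empty, and_false, exists_false, or_false] at hb
    simp [hb, Block.height]
  queries_le i := by simp [Trace.init]

theorem genesis_mem_blocks (τ : Trace ι) : .genesis ∈ τ.blocks := Finset.mem_insert_self _ _

theorem Bounded.known_subset (h : Bounded G r τ) (i : ι) : τ.known i ⊆ τ.blocks := fun b hb => by
  rcases Trace.mem_known.1 hb with rfl | ⟨c, hc, hbc⟩
  · exact genesis_mem_blocks τ
  · refine h.chain_mem c ?_ b hbc
    rcases hc with hc | hc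
    · exact h.recv_mem _ c hc
    · exact Finset.mem_insert_of_mem (Finset.mem_biUnion.2 ⟨i, Finset.mem_univ i, hc⟩)

theorem blocks_nextTrace (L : Finset ι) (o : Option ι → List (Block ι)) :
    (nextTrace G act r τ L o).blocks = τ.blocks ∪ Finset.univ.biUnion fun i =>
      newBlocks G.queryBound τ r L i (act i (τ.records i) (decide (i ∈ L))) := by
  ext b
  simp only [Trace.blocks, nextTrace, Finset.mem_insert, Finset.mem_biUnion, Finset.mem_univ,
    true_and, Finset.mem_union, exists_or, or_assoc]

theorem card_newBlocks_le {ι : Type*} [DecidableEq ι] (q : ℕ) (τ : Trace ι) (r : ℕ)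
    (L : Finset ι) (i : ι) (a : Action ι) :
    (newBlocks q τ r L i a).card ≤ q := by
  unfold newBlocks
  split_ifs
  · refine (List.toFinset_card_le _).trans ?_
    rw [List.length_map]
    refine (List.length_filter_le _ _).trans ?_
    rw [queriesOf, List.length_take]
    exact min_le_left _ _
  · simp

theorem Bounded.slotMessages_subset (h : Bounded G r τ) (L : Finset ι)
    (o : Option ι → List (Block ι)) :
    slotMessages G act r τ L ⊆ (nextTrace G act r τ L o).blocks := fun b hb => by
  rw [blocks_nextTrace, Finset.mem_union]
  obtain ⟨i, _, hi⟩ := Finset.mem_biUnion.1 hb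
  rcases Finset.mem_union.1 (Finset.mem_inter.1 hi).2 with hb | hb
  · exact Or.inl (h.known_subset i hb)
  · exact Or.inr (Finset.mem_biUnion.2 ⟨i, Finset.mem_univ i, hb⟩)

theorem Bounded.card_blocks_nextTrace (h : Bounded G r τ) (L : Finset ι)
    (o : Option ι → List (Block ι)) : (nextTrace G act r τ L o).blocks.card ≤
      1 + (r + 1) * (Fintype.card ι * G.queryBound) := by
  rw [blocks_nextTrace]
  refine (Finset.card_union_le _ _).trans ?_
  have h1 := h.card_le
  have h2 : (Finset.univ.biUnion fun i =>
      newBlocks G.queryBound τ r L i (act i (τ.records i) (decide (i ∈ L)))).card ≤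
      Fintype.card ι * G.queryBound := by
    rw [← Finset.card_univ]
    exact Finset.card_biUnion_le_card_mul _ _ _ fun i _ => card_newBlocks_le _ _ _ _ _ _
  rw [add_mul, one_mul]
  omega

theorem Bounded.nextTrace (h : Bounded G r τ) {L : Finset ι} {o : Option ι → List (Block ι)}
    (ho : o ∈ deliveries (slotMessages G act r τ L)) :
    Bounded G (r + 1) (nextTrace G act r τ L o) where
  recv_mem x b hb := by
    rw [recv_nextTrace, List.mem_append] at hb
    rcases hb with hb | hb
    · rw [blocks_nextTrace]
      exact Finset.mem_union_left _ (h.recv_mem x b hb)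
    · exact h.slotMessages_subset L o ((mem_of_mem_orderings (mem_deliveries.1 ho x)).1 hb)
  chain_mem b hb c hc := by
    rw [blocks_nextTrace] at hb ⊢
    rcases Finset.mem_union.1 hb with hb' | hb'
    · exact Finset.mem_union_left _ (h.chain_mem b hb' c hc)
    · obtain ⟨i, _, hi⟩ := Finset.mem_biUnion.1 hb'
      obtain ⟨_, x, _, hx, rfl⟩ := mem_newBlocks.1 hi
      rw [Block.chain, List.mem_cons] at hc
      rcases hc with rfl | hc
      · exact hb
      · exact Finset.mem_union_left _ (h.chain_mem _ (h.known_subset i hx) c hc)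
  card_le := h.card_blocks_nextTrace L o
  height_le b hb := by
    rw [blocks_nextTrace] at hb
    rcases Finset.mem_union.1 hb with hb | hb
    · exact (h.height_le b hb).trans (Nat.le_succ _)
    · obtain ⟨i, _, hi⟩ := Finset.mem_biUnion.1 hb
      obtain ⟨_, x, _, hx, rfl⟩ := mem_newBlocks.1 hi
      exact Nat.succ_le_succ (h.height_le _ (h.known_subset i hx))
  queries_le i := by
    have h1 := h.queries_le i
    have h2 : (queriesOf G.queryBound (act i (τ.records i) (decide (i ∈ L)))).length ≤
        G.queryBound := by
      rw [queriesOf, List.length_take]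
      exact min_le_left _ _
    simp only [MLPoS.nextTrace, add_mul, one_mul]
    omega

theorem card_orderings_le {ι : Type*} [DecidableEq ι] (msgs : Finset (Block ι)) :
    (orderings msgs).card ≤ msgs.card.factorial := by
  refine (List.toFinset_card_le _).trans ?_
  rw [List.length_permutations, Finset.length_toList]

theorem card_deliveries_le {msgs : Finset (Block ι)} {M : ℕ} (h : msgs.card ≤ M) :
    (deliveries msgs).card ≤ M.factorial ^ (Fintype.card (Option ι)) := by
  rw [deliveries, Fintype.card_piFinset, Finset.prod_const, Finset.card_univ]
  exact Nat.pow_le_pow_left ((card_orderings_le msgs).trans (Nat.factorial_le h)) _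

/-- An expectation takes only finitely many values, whatever the strategies are. -/
theorem finite_values (G : Params ι) {f : Trace ι → ℝ} (n r : ℕ)
    (hf : {y | ∃ τ, Bounded G (r + n) τ ∧ f τ = y}.Finite) :
    {y | ∃ act τ, Bounded G r τ ∧ value G act r n f τ = y}.Finite := by
  induction n generalizing r with
  | zero =>
    refine hf.subset ?_
    rintro y ⟨_, τ, hτ, rfl⟩
    exact ⟨τ, hτ, rfl⟩
  | succ n ih =>
    have hF := ih (r + 1) (by rwa [show r + 1 + n = r + (n + 1) by omega])
    set M := (1 + (r + 1) * (Fintype.card ι * G.queryBound)).factorial ^ (Fintype.card (Option ι))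
    have hE := finite_expect_values (β := Option ι → List (Block ι)) hF M
    refine ((Set.Finite.pi' fun _ : Finset ι => hE).image
      fun v => ∑ L, slotWeight G r L * v L).subset ?_
    rintro y ⟨act, τ, hτ, rfl⟩
    refine ⟨fun L => (deliveries (slotMessages G act r τ L)).expect fun o =>
      value G act (r + 1) n f (nextTrace G act r τ L o), fun L => ?_, rfl⟩
    refine ⟨_, card_deliveries_le ?_, _, fun o ho => ⟨act, _, hτ.nextTrace ho, rfl⟩, rfl⟩
    -- The set of blocks after the slot does not depend on the delivery, so an empty one serves to
    -- bound the number of messages.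
    exact (Finset.card_le_card (hτ.slotMessages_subset L fun _ => [])).trans
      (hτ.card_blocks_nextTrace L _)

theorem Bounded.ownBlocks_tip_le (h : Bounded G r τ) (P : ι) (x : Option ι) :
    ownBlocks P (τ.tip x) ≤ r := by
  refine (ownBlocks_le_height P _).trans ?_
  rcases τ.tip_mem x with h0 | h0
  · rw [h0]
    exact Nat.zero_le _
  · exact h.height_le _ (h.recv_mem x _ h0)

/-- Against honest parties there is a deterministic best response for `P`. -/
theorem exists_best_rule (G : Params ι) (P : ι) (R C : ℝ) (N : ℕ) :
    ∃ s, ∀ s', value G (deviation P s') 0 N (profit R C P) (Trace.init ι) ≤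
      value G (deviation P s) 0 N (profit R C P) (Trace.init ι) := by
  -- At the end the profit is determined by two bounded natural numbers, the own blocks in the
  -- observer's chain and the queries. Strategies themselves are infinitely many, since the contents
  -- of blocks are arbitrary numbers.
  have hf : {y | ∃ τ, Bounded G (0 + N) τ ∧ profit R C P τ = y}.Finite := by
    refine (Set.finite_range fun c : Fin (0 + N + 1) × Fin ((0 + N) * G.queryBound + 1) =>
      ((c.1 : ℕ) : ℝ) * R - ((c.2 : ℕ) : ℝ) * C).subset ?_
    rintro y ⟨τ, hτ, rfl⟩
    exact ⟨(⟨_, Nat.lt_succ_of_le (hτ.ownBlocks_tip_le P none)⟩,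
      ⟨_, Nat.lt_succ_of_le (hτ.queries_le P)⟩), rfl⟩
  have hfin : (Set.range fun s : List (SlotRecord ι) → Bool → Action ι =>
      value G (deviation P s) 0 N (profit R C P) (Trace.init ι)).Finite := by
    refine (finite_values G N 0 hf).subset ?_
    rintro y ⟨s, rfl⟩
    exact ⟨_, _, bounded_init G, rfl⟩
  obtain ⟨_, ⟨s, rfl⟩, hs⟩ := hfin.exists_maximal ⟨_, Set.mem_range_self (siblingRule 1 P)⟩
  refine ⟨s, fun s' => ?_⟩
  by_contra hlt
  exact hlt (hs (Set.mem_range_self s') (not_le.1 hlt).le)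

end Bounded

/-! ### Invariants while `P` does not lead -/

section Invariants

variable {ι : Type*} [DecidableEq ι] {P : ι} {r c : ℕ} {τ τ' : Trace ι}

/-- No chain in the trace has more than `c` blocks of `P`. -/
structure OwnLe (P : ι) (c : ℕ) (τ : Trace ι) : Prop where
  recv : ∀ x, ∀ b ∈ τ.recv x, ownBlocks P b ≤ c
  created : ∀ i, ∀ b ∈ τ.created i, ownBlocks P b ≤ c

theorem OwnLe.known (h : OwnLe P c τ) {i : ι} {b : Block ι} (hb : b ∈ τ.known i) :
    ownBlocks P b ≤ c := by
  rcases Trace.mem_known.1 hb with rfl | ⟨d, hd, hbd⟩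
  · exact Nat.zero_le _
  · refine (ownBlocks_le_of_mem_chain P hbd).trans ?_
    rcases hd with hd | hd
    exacts [h.recv _ d hd, h.created i d hd]

theorem OwnLe.ownTip_le (h : OwnLe P c τ) (x : Option ι) : ownTip P x τ ≤ c := by
  rw [ownTip, Nat.cast_le]
  rcases τ.tip_mem x with h0 | h0
  · rw [h0]
    exact Nat.zero_le _
  · exact h.recv x _ h0

/-- `P` has not led a slot. -/
def NeverLed (P : ι) (τ : Trace ι) : Prop := ∀ x ∈ τ.records P, x.isLeader = false

/-- What is known about a trace before slot `r` if `P` has not led a slot. -/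
structure Clean (P : ι) (r : ℕ) (τ : Trace ι) : Prop where
  created : τ.created P = ∅
  own : OwnLe P 0 τ
  synced : ∃ m, Synced P r m τ

theorem clean_init (P : ι) : Clean P 0 (Trace.init ι) where
  created := rfl
  own := ⟨fun x b hb => by cases x <;> simp [Trace.recv, Trace.init] at hb,
    fun i b hb => by simp [Trace.init] at hb⟩
  synced := ⟨0, synced_init P⟩

variable [Fintype ι] {G : Params ι} {act : ι → List (SlotRecord ι) → Bool → Action ι}
  {s : List (SlotRecord ι) → Bool → Action ι}

/-- A block by another party inherits the count of its parent, and diffusing known blocks creates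
nothing; so only the new blocks of `P` can raise the bound. -/
theorem OwnLe.nextTrace (h : OwnLe P c τ) {L : Finset ι} {o : Option ι → List (Block ι)}
    (ho : o ∈ deliveries (slotMessages G act r τ L))
    (hnew : ∀ b ∈ newBlocks G.queryBound τ r L P (act P (τ.records P) (decide (P ∈ L))),
      ownBlocks P b ≤ c) : OwnLe P c (nextTrace G act r τ L o) := by
  have hnew' : ∀ i, ∀ b ∈ newBlocks G.queryBound τ r L i (act i (τ.records i) (decide (i ∈ L))),
      ownBlocks P b ≤ c := fun i b hb => by
    rcases eq_or_ne i P with rfl | hi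
    · exact hnew b hb
    · obtain ⟨_, x, _, hx, rfl⟩ := mem_newBlocks.1 hb
      rw [ownBlocks_mk, if_neg hi, add_zero]
      exact h.known hx
  refine ⟨fun x b hb => ?_, fun i b hb => ?_⟩
  · rw [recv_nextTrace, List.mem_append] at hb
    rcases hb with hb | hb
    · exact h.recv x b hb
    · have hb := (mem_of_mem_orderings (mem_deliveries.1 ho x)).1 hb
      obtain ⟨i, _, hi⟩ := Finset.mem_biUnion.1 hb
      rcases Finset.mem_union.1 (Finset.mem_inter.1 hi).2 with hb | hb
      exacts [h.known hb, hnew' i b hb]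
  · rcases Finset.mem_union.1 hb with hb | hb
    exacts [h.created i b hb, hnew' i b hb]

theorem OwnLe.ownBlocks_newBlocks_le (h : OwnLe P c τ) {L : Finset ι} {a : Action ι}
    {b : Block ι} (hb : b ∈ newBlocks G.queryBound τ r L P a) : ownBlocks P b ≤ c + 1 := by
  obtain ⟨_, x, _, hx, rfl⟩ := mem_newBlocks.1 hb
  rw [ownBlocks_mk, if_pos rfl]
  exact Nat.succ_le_succ (h.known hx)

/-- If `P` has no stake, then it gets no additional blocks. -/
theorem OwnLe.value_ownTip_le (h : OwnLe P c τ) (r n : ℕ)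
    (hP : ∀ k, r ≤ k → k < r + n → ∀ L, slotWeight G k L ≠ 0 → P ∉ L) (x : Option ι) :
    value G act r n (ownTip P x) τ ≤ c := by
  rw [← value_const G act r n c τ]
  refine value_mono G act (fun _ τ => OwnLe P c τ) r n ?_ h fun τ' h' => h'.ownTip_le x
  rintro k h1 h2 τ _ hτ ⟨L, hL, o, ho, rfl⟩
  refine hτ.nextTrace ho fun b hb => ?_
  rw [newBlocks_of_notMem _ (hP k h1 h2 L hL)] at hb
  simp at hb

theorem queries_le_value (r n : ℕ) (τ : Trace ι) :
    (τ.queries P : ℝ) ≤ value G act r n (fun τ => (τ.queries P : ℝ)) τ := by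
  rw [← value_const G act r n (τ.queries P : ℝ) τ]
  refine value_mono G act (fun _ τ' => τ.queries P ≤ τ'.queries P) r n ?_ le_rfl
    fun τ' h' => Nat.cast_le.2 h'
  rintro k _ _ τ' _ hτ ⟨L, _, o, _, rfl⟩
  exact hτ.trans (Nat.le_add_right _ _)

theorem mem_support_run_succ (hτ : τ ∈ (run G act r).support) (h : Follows G act r τ τ') :
    τ' ∈ (run G act (r + 1)).support :=
  (PMF.mem_support_bind_iff _ _ _).2 ⟨τ, hτ, (mem_support_step G act r τ τ').2 h⟩

/-- Every reachable trace extends to a later reachable one, and created blocks are never forgotten.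
So a conflict in the middle of an execution shows up in a trace at its end. -/
theorem exists_mem_support_run_add (P : ι) (n : ℕ) (hτ : τ ∈ (run G act r).support) :
    ∃ τ' ∈ (run G act (r + n)).support, τ.created P ⊆ τ'.created P := by
  induction n with
  | zero => exact ⟨τ, hτ, fun _ h => h⟩
  | succ n ih =>
    obtain ⟨τ', hτ', hsub⟩ := ih
    obtain ⟨τ'', h⟩ := (step G act (r + n) τ').support_nonempty
    have hF := (mem_support_step G act _ _ _).1 h
    refine ⟨τ'', mem_support_run_succ hτ' hF, hsub.trans ?_⟩
    obtain ⟨L, _, o, _, rfl⟩ := hF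
    exact Finset.subset_union_left

theorem neverLed_nextTrace {L : Finset ι} {o : Option ι → List (Block ι)} :
    NeverLed P (nextTrace G act r τ L o) ↔ NeverLed P τ ∧ P ∉ L := by
  simp [NeverLed, nextTrace, or_imp, forall_and]

theorem Clean.nextTrace (h : Clean P r τ) (hq : 1 ≤ G.queryBound) {L : Finset ι} (hP : P ∉ L)
    {o : Option ι → List (Block ι)}
    (ho : o ∈ deliveries (slotMessages G (deviation P s) r τ L)) :
    Clean P (r + 1) (nextTrace G (deviation P s) r τ L o) where
  created := by simp [MLPoS.nextTrace, h.created, newBlocks_of_notMem _ hP]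
  own := h.own.nextTrace ho fun b hb => by
    rw [newBlocks_of_notMem _ hP] at hb
    simp at hb
  synced := by
    obtain ⟨m, hm⟩ := h.synced
    exact hm.exists_synced_nextTrace le_rfl hq (fun h => absurd h hP) ho

/-- Since all stakes are below `1 / 2`, every slot has no leader at all with positive probability.
-/
theorem value_neverLed_pos (r n : ℕ)
    (hst : ∀ k, r ≤ k → k < r + n → ∀ i, G.stake (k / G.slotsPerEpoch) i < 1 / 2)
    (hτ : NeverLed P τ) :
    0 < value G act r n (Set.indicator {τ | NeverLed P τ} 1) τ := by
  induction n generalizing r τ with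
  | zero => simp [value, hτ]
  | succ n ih =>
    have h0 : ∀ τ, 0 ≤ value G act (r + 1) n (Set.indicator {τ | NeverLed P τ} 1) τ :=
      value_nonneg G act (r + 1) n fun τ => Set.indicator_nonneg (fun _ _ => zero_le_one) τ
    rw [value, slotMean]
    refine Finset.sum_pos' (fun L _ => mul_nonneg (slotWeight_nonneg G r L)
      (Finset.expect_nonneg fun o _ => h0 _)) ⟨∅, Finset.mem_univ _, mul_pos ?_ ?_⟩
    · exact leaderWeight_pos (hst r le_rfl (by omega)) fun i hi => absurd hi (Finset.notMem_empty i)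
    · refine Finset.expect_pos (fun o _ => ih (r + 1) (fun k h1 h2 => hst k (by omega) (by omega))
        (neverLed_nextTrace.2 ⟨hτ, Finset.notMem_empty P⟩)) (deliveries_nonempty _)

end Invariants

/-! ### Improving a rule without conflicts in the last slot of `P` -/

section Splice

variable {ι : Type*} [Fintype ι] [DecidableEq ι] {G : Params ι} {P : ι}
  {s : List (SlotRecord ι) → Bool → Action ι} {r t : ℕ} {R C pl : ℝ} {τ : Trace ι}

/-- Without conflicts, `P` has at most one new block that competes for the longest chain. -/
theorem card_rivalBlocks_le_one {m N : ℕ} (h : Synced P r m τ) (hr : r < N)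
    (hst : ∀ i, G.stake (r / G.slotsPerEpoch) i < 1 / 2)
    (hpos : 0 < G.stake (r / G.slotsPerEpoch) P)
    (hconf : ∀ τ ∈ (run G (deviation P s) N).support, ¬ Conflicting τ P)
    (hτ : τ ∈ (run G (deviation P s) r).support) (L : Finset ι) :
    (rivalBlocks G P s r m τ L).card ≤ 1 := by
  rw [Finset.card_le_one]
  intro b hb b' hb'
  by_contra hne
  obtain ⟨hb, _, hm⟩ := Finset.mem_filter.1 hb
  obtain ⟨hb', _, hm'⟩ := Finset.mem_filter.1 hb'
  have hP : P ∈ L := (mem_newBlocks.1 hb).1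
  -- The set `L` may have probability zero, but `P` creates the same blocks whenever it leads, so
  -- they also occur in the possible slot that `P` leads alone. Both rivals have height exactly `m +
  -- 1`, hence they conflict.
  have hw : slotWeight G r {P} ≠ 0 := by
    refine (leaderWeight_pos hst fun i hi => ?_).ne'
    rwa [Finset.mem_singleton.1 hi]
  obtain ⟨o, ho⟩ := deliveries_nonempty (slotMessages G (deviation P s) r τ {P})
  obtain ⟨τ', hτ', hsub⟩ := exists_mem_support_run_add P (N - (r + 1))
    (mem_support_run_succ hτ ⟨{P}, hw, o, ho, rfl⟩)
  rw [show r + 1 + (N - (r + 1)) = N by omega] at hτ'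
  have hmem : ∀ b ∈ newBlocks G.queryBound τ r L P (s (τ.records P) (decide (P ∈ L))),
      b ∈ τ'.created P := fun b hb => by
    refine hsub (Finset.mem_union_right _ ?_)
    rw [deviation_self]
    rw [mem_newBlocks] at hb ⊢
    simpa [hP] using hb
  refine hconf τ' hτ' ⟨b, hmem b hb, b', hmem b' hb', ?_, hne⟩
  have h1 := h.height_newBlocks hb
  have h2 := h.height_newBlocks hb'
  omega

/-- If `P` has at most one competing block in its first and last slot as a leader, then its expected
number of blocks in the longest chain is at most the chance of one among the competitors. -/
theorem Clean.expect_ownTip_le {m n : ℕ} (h : Clean P r τ) (hm : Synced P r m τ)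
    (hq : 1 ≤ G.queryBound) {L : Finset ι}
    (hlast : ∀ k, r < k → k < r + 1 + n → G.stake (k / G.slotsPerEpoch) P = 0)
    (hcard : (rivalBlocks G P s r m τ L).card ≤ 1) :
    ((deliveries (slotMessages G (deviation P s) r τ L)).expect fun o =>
      value G (deviation P s) (r + 1) n (ownTip P none)
        (MLPoS.nextTrace G (deviation P s) r τ L o)) ≤ 1 / (1 + (L.erase P).card) := by
  have hlead : ∀ k, r + 1 ≤ k → k < r + 1 + n → ∀ L, slotWeight G k L ≠ 0 → P ∉ L :=
    fun k h1 h2 L hL => notMem_of_stake_eq_zero (hlast k h1 h2) hL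
  -- If `P` has no competitor it may withhold its block and get ahead, so equal heights can fail;
  -- but then the trivial bound of one own block is what is claimed. A competitor restores equal
  -- heights.
  rcases Finset.eq_empty_or_nonempty (L.erase P) with hL | hL
  · rw [hL, Finset.card_empty, Nat.cast_zero, add_zero, div_one]
    refine Finset.expect_le (deliveries_nonempty _) fun o ho => ?_
    have h1 : OwnLe P 1 (MLPoS.nextTrace G (deviation P s) r τ L o) :=
      OwnLe.nextTrace ⟨fun x b hb => (h.own.recv x b hb).trans zero_le_one,
        fun i b hb => (h.own.created i b hb).trans zero_le_one⟩ ho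
        fun b hb => h.own.ownBlocks_newBlocks_le hb
    exact_mod_cast h1.value_ownTip_le (r + 1) n hlead none
  · have hc : candidates G P s r m τ L ≠ 0 := by
      have := Finset.card_pos.2 hL
      rw [candidates]
      omega
    -- `P` cannot lead after slot `r`, so the condition on `s` is vacuous and the formula may be
    -- used with `t = 1`. Its gains vanish, and only a convex combination of the counts at the tips
    -- remains.
    obtain ⟨c, hc0, hc1, hval⟩ := exists_value_ownTip G P s le_rfl hq (r + 1) n
      (fun k h1 h2 L hL hP => absurd hP (hlead k h1 h2 L hL)) none
    have hgain : ∑ j ∈ Finset.range n,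
        siblingGain (G.stake ((r + 1 + j) / G.slotsPerEpoch)) P 1 = 0 :=
      Finset.sum_eq_zero fun j hj => siblingGain_of_stake_eq_zero _ _
        (hlast _ (by omega) (by have := Finset.mem_range.1 hj; omega)) _
    rw [Finset.expect_congr rfl fun o ho => by
      rw [hval _ _ (hm.nextTrace_of_candidates hq hc ho), hgain, add_zero],
      Finset.expect_sum_comm]
    have hx : ∀ x, ((deliveries (slotMessages G (deviation P s) r τ L)).expect fun o =>
        c x * ownTip P x (MLPoS.nextTrace G (deviation P s) r τ L o)) ≤
        c x * (1 / (1 + (L.erase P).card)) := by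
      intro x
      rw [← Finset.mul_expect]
      refine mul_le_mul_of_nonneg_left ?_ (hc0 x)
      have h1 := hm.expect_tip (s := s) hq L hc x fun b => (ownBlocks P b : ℝ)
      simp only [ownTip] at h1 ⊢
      have h2 : ∑ i ∈ L.erase P, (ownBlocks P (honestBlock τ r i) : ℝ) = 0 :=
        Finset.sum_eq_zero fun i hi => by
          rw [ownBlocks_honestBlock (Finset.ne_of_mem_erase hi)]
          exact le_antisymm ((h.own.ownTip_le (some i)).trans_eq Nat.cast_zero) (Nat.cast_nonneg _)
      have h3 : ∑ b ∈ rivalBlocks G P s r m τ L, (ownBlocks P b : ℝ) ≤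
          (rivalBlocks G P s r m τ L).card := by
        rw [← nsmul_one]
        refine Finset.sum_le_card_nsmul _ _ _ fun b hb => ?_
        exact_mod_cast h.own.ownBlocks_newBlocks_le (Finset.mem_filter.1 hb).1
      have h4 : ((rivalBlocks G P s r m τ L).card : ℝ) ≤ 1 := by exact_mod_cast hcard
      have h5 : (0 : ℝ) < (L.erase P).card := by exact_mod_cast Finset.card_pos.2 hL
      have h6 : (0 : ℝ) ≤ (rivalBlocks G P s r m τ L).card := Nat.cast_nonneg _
      rw [h1, h2, zero_add, candidates]
      push_cast
      -- With `k` competitors and `b ≤ 1` rivals, `b / (k + b)` is at most `1 / (1 + k)`.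
      rw [div_le_div_iff₀ (by linarith) (by linarith)]
      nlinarith
    refine (Finset.sum_le_sum fun x _ => hx x).trans_eq ?_
    rw [← Finset.sum_mul, hc1, one_mul]

/-- Without conflicts, the expected profit that `P` makes from its only slot as a leader. -/
theorem Clean.value_profit_le {m n N : ℕ} (h : Clean P r τ) (hm : Synced P r m τ)
    (hq : 1 ≤ G.queryBound) (hC : 0 ≤ C) (hR : 0 < R)
    (hlast : ∀ k, r < k → k < r + 1 + n → G.stake (k / G.slotsPerEpoch) P = 0)
    (hN : r < N) (hst : ∀ i, G.stake (r / G.slotsPerEpoch) i < 1 / 2)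
    (hpos : 0 < G.stake (r / G.slotsPerEpoch) P)
    (hconf : ∀ τ ∈ (run G (deviation P s) N).support, ¬ Conflicting τ P)
    (hτ : τ ∈ (run G (deviation P s) r).support) :
    value G (deviation P s) r (n + 1) (profit R C P) τ ≤ - (τ.queries P * C) +
      max 0 (siblingGain (G.stake (r / G.slotsPerEpoch)) P 1 * R -
        G.stake (r / G.slotsPerEpoch) P * C) := by
  have hlead : ∀ k, r + 1 ≤ k → k < r + 1 + n → ∀ L, slotWeight G k L ≠ 0 → P ∉ L :=
    fun k h1 h2 L hL => notMem_of_stake_eq_zero (hlast k h1 h2) hL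
  -- The number of queries that `P` makes as a leader cannot depend on who else leads. So over all
  -- `L` at once, either `P` makes no query or it pays at least `C` whenever it leads; this gives
  -- the maximum in the statement.
  set ℓ := (queriesOf G.queryBound (s (τ.records P) true)).length with hℓ
  -- the profit after a slot with leaders `L`
  have hslot : ∀ L, ((deliveries (slotMessages G (deviation P s) r τ L)).expect fun o =>
      value G (deviation P s) (r + 1) n (profit R C P)
        (MLPoS.nextTrace G (deviation P s) r τ L o)) ≤ - (τ.queries P * C) +
      if P ∈ L then (if ℓ = 0 then 0 else 1 / (1 + ((L.erase P).card : ℝ)) * R - C) else 0 := by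
    intro L
    set E := (deliveries (slotMessages G (deviation P s) r τ L)).expect fun o =>
      value G (deviation P s) (r + 1) n (ownTip P none)
        (MLPoS.nextTrace G (deviation P s) r τ L o) with hE
    have hcost : ∀ o, ((τ.queries P : ℝ) + if P ∈ L then (ℓ : ℝ) else 0) * C ≤
        value G (deviation P s) (r + 1) n (fun τ => (τ.queries P : ℝ))
          (MLPoS.nextTrace G (deviation P s) r τ L o) * C := fun o => by
      refine mul_le_mul_of_nonneg_right (le_trans ?_ (queries_le_value _ _ _)) hC
      have : (MLPoS.nextTrace G (deviation P s) r τ L o).queries P = τ.queries P +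
        (queriesOf G.queryBound (s (τ.records P) (decide (P ∈ L)))).length := by
        simp only [MLPoS.nextTrace, deviation_self]
      rw [this]
      by_cases hP : P ∈ L <;> simp [hP, hℓ]
    have hle : ((deliveries (slotMessages G (deviation P s) r τ L)).expect fun o =>
        value G (deviation P s) (r + 1) n (profit R C P)
          (MLPoS.nextTrace G (deviation P s) r τ L o)) ≤
        E * R - ((τ.queries P : ℝ) + if P ∈ L then (ℓ : ℝ) else 0) * C := by
      refine (Finset.expect_le_expect fun o _ => ?_).trans_eq
        ((Finset.expect_sub_distrib _ _ _).trans (congrArg₂ (· - ·)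
          (Finset.expect_mul _ _ _).symm (Finset.expect_const (deliveries_nonempty _) _)))
      rw [value_profit]
      exact sub_le_sub_left (hcost o) _
    have hE0 : (P ∈ L → ℓ = 0) → E ≤ 0 := fun hnew => by
      refine Finset.expect_le (deliveries_nonempty _) fun o ho => ?_
      refine (OwnLe.value_ownTip_le (c := 0) (h.own.nextTrace ho fun b hb => ?_)
        (r + 1) n hlead none).trans_eq Nat.cast_zero
      obtain ⟨hP, x, hx, _⟩ := mem_newBlocks.1 hb
      have h0 := hnew hP
      rw [hℓ, List.length_eq_zero_iff] at h0
      rw [deviation_self, decide_eq_true hP, h0] at hx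
      simp at hx
    refine hle.trans ?_
    split_ifs with hP hl
    · rw [hl]
      have := mul_nonpos_of_nonpos_of_nonneg (hE0 fun _ => hl) hR.le
      push_cast
      linarith
    · have h1 : E ≤ 1 / (1 + (L.erase P).card) := h.expect_ownTip_le hm hq hlast
        (card_rivalBlocks_le_one hm hN hst hpos hconf hτ L)
      have h2 : (1 : ℝ) ≤ ℓ := by exact_mod_cast Nat.one_le_iff_ne_zero.2 hl
      have h3 := mul_le_mul_of_nonneg_right h1 hR.le
      have h4 := mul_le_mul_of_nonneg_right h2 hC
      linarith
    · have := mul_nonpos_of_nonpos_of_nonneg (hE0 fun h => absurd h hP) hR.le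
      linarith
  rw [value, slotMean]
  refine (Finset.sum_le_sum fun L _ => mul_le_mul_of_nonneg_left (hslot L)
    (slotWeight_nonneg G r L)).trans ?_
  simp only [mul_add, Finset.sum_add_distrib, ← Finset.sum_mul, sum_slotWeight, one_mul]
  refine add_le_add le_rfl ?_
  split_ifs with hl
  · simp
  · refine le_trans (le_of_eq ?_) (le_max_right _ _)
    rw [← sum_leaderWeight_mem_const, siblingGain, Finset.sum_mul, ← Finset.sum_sub_distrib]
    refine Finset.sum_congr rfl fun L _ => ?_
    rw [slotWeight]
    split_ifs
    · push_cast
      ring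
    · ring

/-- The expected profit of a party that makes sibling blocks. -/
theorem Clean.value_profit_siblingRule (h : Clean P r τ) (ht1 : 1 ≤ t) (ht : t ≤ G.queryBound)
    (n : ℕ) : value G (deviation P (siblingRule t P)) r n (profit R C P) τ =
      - (τ.queries P * C) + ∑ j ∈ Finset.range n,
        (siblingGain (G.stake ((r + j) / G.slotsPerEpoch)) P t * R -
          G.stake ((r + j) / G.slotsPerEpoch) P * t * C) := by
  obtain ⟨m, hm⟩ := h.synced
  obtain ⟨c, _, _, hval⟩ := exists_value_ownTip G P (siblingRule t P) ht1 ht r n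
    (fun _ _ _ _ _ _ => rfl) none
  have h0 : ∀ y, ownTip P y τ = 0 := fun y =>
    le_antisymm ((h.own.ownTip_le y).trans_eq Nat.cast_zero) (Nat.cast_nonneg _)
  rw [value_profit, hval τ m hm, value_queries_siblingRule ht, Finset.sum_sub_distrib]
  simp only [h0, mul_zero, Finset.sum_const_zero, zero_add, ← Finset.sum_mul]
  ring

/-- The expected profit that `P` makes from its only slot as a leader with sibling blocks. -/
theorem Clean.value_profit_siblingRule_of_last {n : ℕ} (h : Clean P r τ) (ht1 : 1 ≤ t)
    (ht : t ≤ G.queryBound)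
    (hlast : ∀ k, r < k → k < r + 1 + n → G.stake (k / G.slotsPerEpoch) P = 0) :
    value G (deviation P (siblingRule t P)) r (n + 1) (profit R C P) τ = - (τ.queries P * C) +
      (siblingGain (G.stake (r / G.slotsPerEpoch)) P t * R -
        G.stake (r / G.slotsPerEpoch) P * t * C) := by
  rw [h.value_profit_siblingRule ht1 ht, Finset.sum_range_succ', Finset.sum_eq_zero, add_zero,
    zero_add]
  intro j hj
  have hz := hlast (r + (j + 1)) (by omega) (by have := Finset.mem_range.1 hj; omega)
  rw [hz, siblingGain_of_stake_eq_zero _ _ hz]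
  ring

/-- Sibling blocks beat every strategy without conflicts. -/
theorem Clean.value_profit_add_le {m n N : ℕ} (h : Clean P r τ) (hm : Synced P r m τ)
    (ht2 : 2 ≤ t) (ht : t ≤ G.queryBound) (hC : 0 ≤ C) (hR : 0 < R)
    (hlast : ∀ k, r < k → k < r + 1 + n → G.stake (k / G.slotsPerEpoch) P = 0)
    (hN : r < N) (hst : ∀ i, G.stake (r / G.slotsPerEpoch) i < 1 / 2)
    (hpos : 0 < G.stake (r / G.slotsPerEpoch) P)
    (hpl : pl ≤ multiLeaderProb (G.stake (r / G.slotsPerEpoch)))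
    (hprofit : C < pl * R / (2 * (t + 1)))
    (hconf : ∀ τ ∈ (run G (deviation P s) N).support, ¬ Conflicting τ P)
    (hτ : τ ∈ (run G (deviation P s) r).support) :
    value G (deviation P s) r (n + 1) (profit R C P) τ +
        G.stake (r / G.slotsPerEpoch) P * (pl * R / (2 * (t + 1)) - C) ≤
      value G (deviation P (siblingRule t P)) r (n + 1) (profit R C P) τ := by
  set μ := G.stake (r / G.slotsPerEpoch)
  have hle := h.value_profit_le hm (by omega) hC hR hlast hN hst hpos hconf hτ
  rw [h.value_profit_siblingRule_of_last (by omega) ht hlast]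
  have ht' : (2 : ℝ) ≤ t := by exact_mod_cast ht2
  have hδ : 0 < pl * R / (2 * (t + 1)) - C := by linarith
  have hg1 := siblingGain_sub_ge μ P (hst P) t ht2
  have hg := siblingGain_ge μ P (hst P) t ht2
  -- The surplus of siblings has this form with `a = t - 1` against a single block and with `a = t`
  -- against no query. Both factors are at least `1`, so one margin covers both cases.
  have key : ∀ a : ℝ, 1 ≤ a → μ P * (pl * R / (2 * (t + 1)) - C) ≤
      μ P * (a / (2 * (t + 1)) * multiLeaderProb μ) * R - μ P * a * C := fun a ha => by
    have h1 : a / (2 * (t + 1)) * pl ≤ a / (2 * (t + 1)) * multiLeaderProb μ :=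
      mul_le_mul_of_nonneg_left hpl (div_nonneg (by linarith) (by linarith))
    have h2 := mul_le_mul_of_nonneg_left (mul_le_mul_of_nonneg_right h1 hR.le) hpos.le
    have h3 : μ P * (pl * R / (2 * (t + 1)) - C) ≤ μ P * (a * (pl * R / (2 * (t + 1)) - C)) :=
      mul_le_mul_of_nonneg_left (le_mul_of_one_le_left hδ.le ha) hpos.le
    have h4 : μ P * (a * (pl * R / (2 * (t + 1)) - C)) =
      μ P * (a / (2 * (t + 1)) * pl * R) - μ P * a * C := by ring
    linarith
  have h1 := key (t - 1) (by linarith)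
  have h2 := key t (by linarith)
  have hg1R := mul_le_mul_of_nonneg_right hg1 hR.le
  have hgR := mul_le_mul_of_nonneg_right hg hR.le
  rcases max_cases 0 (siblingGain μ P 1 * R - μ P * C) with ⟨hmax, _⟩ | ⟨hmax, _⟩
  · rw [hmax] at hle
    linarith
  · rw [hmax] at hle
    linarith

/-- Follow the rule `s`, but make `t` sibling blocks from slot `r` on if `P` has not led a slot
before slot `r`. -/
def splicedRule (P : ι) (r t : ℕ) (s : List (SlotRecord ι) → Bool → Action ι)
    (past : List (SlotRecord ι)) (isLeader : Bool) : Action ι :=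
  -- Only the first `r` records are inspected, so the choice made in slot `r` stays fixed for the
  -- rest of the execution.
  if r ≤ past.length ∧ ∀ x ∈ past.take r, x.isLeader = false then siblingRule t P past isLeader
  else s past isLeader

theorem value_splicedRule_of_neverLed (n : ℕ) (f : Trace ι → ℝ)
    (hlen : (τ.records P).length = r) (hτ : NeverLed P τ) :
    value G (deviation P (splicedRule P r t s)) r n f τ =
      value G (deviation P (siblingRule t P)) r n f τ := by
  refine value_congr_act G _ (fun _ τ => r ≤ (τ.records P).length ∧
    ∀ x ∈ (τ.records P).take r, x.isLeader = false) r n f ?_ ?_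
    ⟨hlen.ge, fun x hx => hτ x (List.mem_of_mem_take hx)⟩
  · rintro k _ _ τ _ hJ ⟨L, _, o, _, rfl⟩
    simp only [nextTrace, List.take_append_of_le_length hJ.1]
    exact ⟨hJ.1.trans (by simp), hJ.2⟩
  · intro k _ _ τ hJ i
    rcases eq_or_ne i P with rfl | hi
    · funext b
      rw [deviation_self, deviation_self, splicedRule, if_pos hJ]
    · rw [deviation_of_ne hi, deviation_of_ne hi]

theorem value_splicedRule_of_not_neverLed (n : ℕ) (f : Trace ι → ℝ)
    (hlen : (τ.records P).length = r) (hτ : ¬ NeverLed P τ) :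
    value G (deviation P (splicedRule P r t s)) r n f τ = value G (deviation P s) r n f τ := by
  refine value_congr_act G _ (fun _ τ => r ≤ (τ.records P).length ∧
    ¬ ∀ x ∈ (τ.records P).take r, x.isLeader = false) r n f ?_ ?_
    ⟨hlen.ge, by rwa [List.take_of_length_le hlen.le]⟩
  · rintro k _ _ τ _ hJ ⟨L, _, o, _, rfl⟩
    simp only [nextTrace, List.take_append_of_le_length hJ.1]
    exact ⟨hJ.1.trans (by simp), hJ.2⟩
  · intro k _ _ τ hJ i
    rcases eq_or_ne i P with rfl | hi
    · funext b
      rw [deviation_self, deviation_self, splicedRule, if_neg fun h => hJ.2 h.2]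
    · rw [deviation_of_ne hi, deviation_of_ne hi]

/-- Before slot `r` there are fewer than `r` records, so both rules act alike and produce the same
law of the trace at slot `r`. -/
theorem value_splicedRule_init (f : Trace ι → ℝ) :
    value G (deviation P (splicedRule P r t s)) 0 r f (Trace.init ι) =
      value G (deviation P s) 0 r f (Trace.init ι) := by
  refine value_congr_act G _ (fun k τ => (τ.records P).length = k) 0 r f ?_ ?_ rfl
  · rintro k _ _ τ _ hJ ⟨L, _, o, _, rfl⟩
    simp [nextTrace, hJ]
  · intro k _ hk τ hJ i
    rcases eq_or_ne i P with rfl | hi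
    · funext b
      rw [deviation_self, deviation_self, splicedRule, if_neg fun h => by omega]
    · rw [deviation_of_ne hi, deviation_of_ne hi]

/-- A rule that never creates conflicts is not a best response. -/
theorem exists_better_rule {n : ℕ} (ht2 : 2 ≤ t) (ht : t ≤ G.queryBound) (hC : 0 ≤ C)
    (hR : 0 < R) (hst : ∀ k ≤ r, ∀ i, G.stake (k / G.slotsPerEpoch) i < 1 / 2)
    (hpos : 0 < G.stake (r / G.slotsPerEpoch) P)
    (hlast : ∀ k, r < k → k < r + 1 + n → G.stake (k / G.slotsPerEpoch) P = 0)
    (hpl : pl ≤ multiLeaderProb (G.stake (r / G.slotsPerEpoch)))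
    (hprofit : C < pl * R / (2 * (t + 1)))
    (hconf : ∀ τ ∈ (run G (deviation P s) (r + (n + 1))).support, ¬ Conflicting τ P) :
    ∃ s', value G (deviation P s) 0 (r + (n + 1)) (profit R C P) (Trace.init ι) <
      value G (deviation P s') 0 (r + (n + 1)) (profit R C P) (Trace.init ι) := by
  refine ⟨splicedRule P r t s, ?_⟩
  set δ := G.stake (r / G.slotsPerEpoch) P * (pl * R / (2 * (t + 1)) - C)
  have hδ : 0 < δ := mul_pos hpos (by linarith)
  -- Both executions have the same law up to slot `r`, so the improvement is the mean over that law
  -- of the difference of the continuation values: at least `δ` if `P` has never led, and `0`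
  -- otherwise.
  rw [value_add _ _ 0 r (n + 1), value_add _ _ 0 r (n + 1), value_splicedRule_init,
    zero_add, ← sub_pos, ← value_sub_fun]
  have hlow : 0 < δ * value G (deviation P s) 0 r (Set.indicator {τ | NeverLed P τ} 1)
      (Trace.init ι) :=
    mul_pos hδ (value_neverLed_pos 0 r (fun k _ hk => hst k (by omega))
      fun x hx => by simp [Trace.init] at hx)
  rw [← value_const_mul] at hlow
  refine hlow.trans_le (value_mono G _ (fun k τ => τ ∈ (run G (deviation P s) k).support ∧
    (τ.records P).length = k ∧ (NeverLed P τ → Clean P k τ)) 0 r ?_ ?_ ?_)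
  · rintro k _ _ τ _ ⟨h1, h2, h3⟩ ⟨L, hL, o, ho, rfl⟩
    refine ⟨mem_support_run_succ h1 ⟨L, hL, o, ho, rfl⟩, by simp [nextTrace, h2], fun hn => ?_⟩
    obtain ⟨hn, hP⟩ := neverLed_nextTrace.1 hn
    exact (h3 hn).nextTrace (by omega) hP ho
  · exact ⟨by simp [run], rfl, fun _ => clean_init P⟩
  · rintro τ ⟨h1, h2, h3⟩
    rw [zero_add] at h1 h2 h3
    by_cases hn : NeverLed P τ
    · obtain ⟨m, hm⟩ := (h3 hn).synced
      rw [value_splicedRule_of_neverLed _ _ h2 hn, Set.indicator_of_mem (by exact hn)]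
      have := (h3 hn).value_profit_add_le hm ht2 ht hC hR hlast (N := r + (n + 1)) (by omega)
        (hst r le_rfl) hpos hpl hprofit hconf h1
      simp only [Pi.one_apply, mul_one]
      linarith
    · rw [value_splicedRule_of_not_neverLed _ _ h2 hn, Set.indicator_of_notMem (by exact hn)]
      simp

end Splice

/-! ### From rules to strategies, utilities and the cone -/

section Utilities

variable {ι : Type*}

/-- The deterministic strategy that follows a rule. -/
def Strategy.ofRule (s : List (SlotRecord ι) → Bool → Action ι) : Strategy ι where
  coins := 0
  act _ _ := s

theorem sum_stake_eq_expectedSlots [Fintype ι] (stake : ℕ → stdSimplex ℝ ι) (e l : ℕ) (P : ι) :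
    ∑ r ∈ Finset.range (e * l), stake (r / l) P = expectedSlots stake e l P := by
  induction e with
  | zero => simp [expectedSlots]
  | succ e ih =>
    rw [add_mul, one_mul, Finset.sum_range_add, ih, expectedSlots, expectedSlots,
      Finset.sum_range_succ]
    congr 1
    rw [Finset.sum_congr rfl (g := fun _ => stake e P), Finset.sum_const, Finset.card_range,
      nsmul_eq_mul]
    intro x hx
    have hx := Finset.mem_range.1 hx
    rw [mul_comm e l, Nat.mul_add_div (by omega), Nat.div_eq_of_lt hx, add_zero]

variable [DecidableEq ι]

theorem act_eq_deviation {P : ι} {σ : ι → Strategy ι} (hσ : ∀ j, j ≠ P → σ j = honest ι)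
    (ω : ∀ i, Fin ((σ i).coins + 1)) :
    (fun i => (σ i).act (ω i) i) = deviation P ((σ P).act (ω P) P) := by
  funext i
  rcases eq_or_ne i P with rfl | hi
  · rw [deviation_self]
  · rw [deviation_of_ne hi]
    -- The type of the coins depends on the strategy, so the equation is generalized before it is
    -- substituted.
    have key : ∀ S : Strategy ι, S = honest ι → ∀ w, S.act w i = siblingRule 1 i := by
      rintro _ rfl w
      exact honest_act w i
    exact key _ (hσ i hi) _

variable [Fintype ι]

/-- The profit of `P` against honest parties is an average over the coins of `P`. -/
theorem profitUtility_eq (G : Params ι) (R C : ℝ) {P : ι} {σ : ι → Strategy ι}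
    (hσ : ∀ j, j ≠ P → σ j = honest ι) : profitUtility G R C P σ =
      expectation (PMF.uniformOfFintype (∀ i, Fin ((σ i).coins + 1))) fun ω =>
        value G (deviation P ((σ P).act (ω P) P)) 0 (G.epochs * G.slotsPerEpoch) (profit R C P)
          (Trace.init ι) := by
  have hfin : (execution G σ).support.Finite :=
    finite_support_bind _ _ (Set.toFinite _) fun _ => finite_support_run _ _ _
  rw [profitUtility, ← expectation_sub _ hfin, execution,
    expectation_bind _ _ _ (Set.toFinite _) fun _ => finite_support_run _ _ _]
  congr 1
  funext ω
  rw [act_eq_deviation hσ, expectation_run]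
  congr 1
  funext τ
  rw [reward_eq]
  rfl

theorem profitUtility_of_act_eq (G : Params ι) (R C : ℝ) {P : ι} {σ : ι → Strategy ι}
    (hσ : ∀ j, j ≠ P → σ j = honest ι) {s : List (SlotRecord ι) → Bool → Action ι}
    (hs : ∀ w, (σ P).act w P = s) : profitUtility G R C P σ =
      value G (deviation P s) 0 (G.epochs * G.slotsPerEpoch) (profit R C P) (Trace.init ι) := by
  rw [profitUtility_eq G R C hσ]
  simp only [hs]
  exact expectation_const _ (Set.toFinite _) _

theorem run_support_subset_traces (G : Params ι) {P : ι} {σ : ι → Strategy ι}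
    (hσ : ∀ j, j ≠ P → σ j = honest ι) {s : List (SlotRecord ι) → Bool → Action ι}
    (hs : ∀ w, (σ P).act w P = s) :
    (run G (deviation P s) (G.epochs * G.slotsPerEpoch)).support ⊆ traces G σ := fun τ hτ => by
  -- Any outcome of the coins has positive probability, and the rule of `P` is the same for all of
  -- them.
  refine (PMF.mem_support_bind_iff _ _ _).2 ⟨fun _ => 0, by simp, ?_⟩
  rwa [act_eq_deviation hσ, hs]

theorem rewardUtility_eq_profitUtility (G : Params ι) (R : ℝ) :
    rewardUtility G R = profitUtility G R 0 := by
  funext i σ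
  simp [rewardUtility, profitUtility, cost, expectation]

/-- Sibling blocks are a profitable deviation from the honest protocol. -/
theorem value_siblingRule_sub_ge (stake : ℕ → stdSimplex ℝ ι) (e l q : ℕ) {R C pl : ℝ} {P : ι}
    (hR : 0 < R) (hstake : ∀ j < e, stake j P < 1 / 2)
    (hpl : ∀ j < e, pl ≤ multiLeaderProb (stake j)) {t : ℕ} (ht2 : 2 ≤ t) (ht : t ≤ q) :
    (((t : ℝ) - 1) / (2 * (t + 1)) * pl * R - ((t : ℝ) - 1) * C) * expectedSlots stake e l P ≤
      value ⟨stake, e, l, q⟩ (deviation P (siblingRule t P)) 0 (e * l) (profit R C P)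
          (Trace.init ι) -
        value ⟨stake, e, l, q⟩ (deviation P (siblingRule 1 P)) 0 (e * l) (profit R C P)
          (Trace.init ι) := by
  have ht' : (2 : ℝ) ≤ t := by exact_mod_cast ht2
  rw [(clean_init P).value_profit_siblingRule (G := ⟨stake, e, l, q⟩) (by omega) ht,
    (clean_init P).value_profit_siblingRule (G := ⟨stake, e, l, q⟩) le_rfl
      (show 1 ≤ q by omega), add_sub_add_left_eq_sub,
    ← Finset.sum_sub_distrib, ← sum_stake_eq_expectedSlots, Finset.mul_sum]
  refine Finset.sum_le_sum fun r hr => ?_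
  have hj : r / l < e := Nat.div_lt_of_lt_mul (by
    rw [mul_comm]
    exact Finset.mem_range.1 hr)
  simp only [zero_add]
  set μ := stake (r / l)
  have h1 := siblingGain_sub_ge μ P (hstake _ hj) t ht2
  have h2 : ((t : ℝ) - 1) / (2 * (t + 1)) * pl ≤
      ((t : ℝ) - 1) / (2 * (t + 1)) * multiLeaderProb μ :=
    mul_le_mul_of_nonneg_left (hpl _ hj) (div_nonneg (by linarith) (by linarith))
  have h3 := mul_le_mul_of_nonneg_right ((mul_le_mul_of_nonneg_left h2 (stake_nonneg μ P)).trans h1)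
    hR.le
  push_cast
  linarith

/-- The honest protocol is not compliant if creating `t` sibling blocks is profitable: every best
response of `P` creates conflicting blocks. -/
theorem not_isCompliantProtocol_profitUtility (stake : ℕ → stdSimplex ℝ ι) (e l q : ℕ)
    {R C pl ε : ℝ} {P : ι} (hR : 0 < R) (hC : 0 ≤ C)
    (hstake : ∀ j < e, ∀ i, stake j i < 1 / 2)
    (hpl : ∀ j < e, pl ≤ multiLeaderProb (stake j)) {t : ℕ} (ht2 : 2 ≤ t) (ht : t ≤ q)
    (hε0 : 0 ≤ ε)
    (hε : ε < (((t : ℝ) - 1) / (2 * (t + 1)) * pl * R - ((t : ℝ) - 1) * C) *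
      expectedSlots stake e l P) :
    ¬ IsCompliantProtocol (traces ⟨stake, e, l, q⟩) Conflicting
      (profitUtility ⟨stake, e, l, q⟩ R C) (honest ι) ε := by
  intro hcompl
  set G : Params ι := ⟨stake, e, l, q⟩
  have ht' : (2 : ℝ) ≤ t := by exact_mod_cast ht2
  have hs0 : 0 ≤ expectedSlots stake e l P := Finset.sum_nonneg fun j _ =>
    mul_nonneg (Nat.cast_nonneg _) (stake_nonneg _ _)
  have hprod := hε0.trans_lt hε
  have hs : 0 < expectedSlots stake e l P := by
    refine lt_of_le_of_ne hs0 fun h => ?_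
    rw [← h, mul_zero] at hprod
    exact lt_irrefl _ hprod
  -- The gain per expected slot is `(t - 1) * (pl * R / (2 * (t + 1)) - C)`; it is positive because
  -- it exceeds `ε ≥ 0` after multiplication by the expected number of slots.
  have hprofit : C < pl * R / (2 * (t + 1)) := by
    have h1 := (pos_iff_pos_of_mul_pos hprod).2 hs
    have h2 : ((t : ℝ) - 1) / (2 * (t + 1)) * pl * R - ((t : ℝ) - 1) * C =
        (t - 1) * (pl * R / (2 * (t + 1)) - C) := by ring
    rw [h2] at h1
    have := pos_of_mul_pos_right h1 (by linarith)
    linarith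
  -- a deterministic best response
  obtain ⟨s, hbest⟩ := exists_best_rule G P R C (e * l)
  set σ : ι → Strategy ι := Function.update (fun _ => honest ι) P (Strategy.ofRule s)
  have hσ : ∀ j, j ≠ P → σ j = honest ι := fun j hj => Function.update_of_ne hj _ _
  have hσP : ∀ w, (σ P).act w P = s := by
    have key : ∀ S : Strategy ι, S = Strategy.ofRule s → ∀ w, S.act w P = s := by
      rintro _ rfl w
      rfl
    exact key _ (Function.update_self _ _ _)
  have hU := profitUtility_of_act_eq G R C hσ hσP
  have hreach : DirectlyReachable (profitUtility G R C) ε (fun _ => honest ι) σ := by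
    refine ⟨P, hσ, ?_, fun σ'' hσ'' => ?_⟩
    · have h1 := profitUtility_of_act_eq G R C (P := P) (σ := fun _ => honest ι)
        (fun _ _ => rfl) fun w => honest_act w P
      have h2 := value_siblingRule_sub_ge stake e l q (C := C) hR (fun j hj => hstake j hj P) hpl
        ht2 ht
      have h3 := hbest (siblingRule t P)
      rw [hU, h1]
      linarith
    -- A randomized deviation is an average over deterministic rules, none of which beats `s`.
    · rw [hU, profitUtility_eq G R C hσ'']
      exact expectation_le_of_forall_le _ (Set.toFinite _) _ _ fun ω => hbest _
  have hcone : σ ∈ cone (profitUtility G R C) ε fun _ => honest ι :=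
    Relation.ReflTransGen.single hreach
  have hconf : ∀ τ ∈ (run G (deviation P s) (e * l)).support, ¬ Conflicting τ P := fun τ hτ =>
    hcompl σ hcone P P σ rfl τ (run_support_subset_traces G hσ hσP hτ)
  -- the last slot that `P` leads with positive probability
  set S := (Finset.range (e * l)).filter fun r => 0 < stake (r / l) P
  have hS : S.Nonempty := by
    rw [← sum_stake_eq_expectedSlots] at hs
    obtain ⟨r, hr, hpos⟩ := Finset.exists_lt_of_sum_lt (s := Finset.range (e * l))
      (f := fun _ => (0 : ℝ)) (by simpa using hs)
    exact ⟨r, Finset.mem_filter.2 ⟨hr, hpos⟩⟩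
  obtain ⟨hr, hpos⟩ := Finset.mem_filter.1 (S.max'_mem hS)
  set r := S.max' hS
  have hr := Finset.mem_range.1 hr
  have hepoch : ∀ k < e * l, k / l < e := fun k hk => Nat.div_lt_of_lt_mul (by rwa [mul_comm])
  have hN : e * l = r + ((e * l - (r + 1)) + 1) := by omega
  rw [hN] at hconf hbest
  have hlast : ∀ k, r < k → k < r + 1 + (e * l - (r + 1)) → stake (k / l) P = 0 := by
    intro k h1 h2
    by_contra h0
    have hk : k ∈ S := Finset.mem_filter.2 ⟨Finset.mem_range.2 (by omega),
      lt_of_le_of_ne (stake_nonneg _ _) (Ne.symm h0)⟩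
    exact absurd (S.le_max' k hk) (not_le.2 h1)
  obtain ⟨s', hs'⟩ := exists_better_rule (G := G) ht2 ht hC hR
    (fun k hk => hstake _ (hepoch k (by omega))) hpos hlast (hpl _ (hepoch r hr)) hprofit hconf
  exact absurd (hbest s') (not_le.2 hs')

end Utilities

end MLPoS

/-! ### The theorem -/

theorem mainTheorem9 {ι : Type*} [Fintype ι] [DecidableEq ι]
    (stake : ℕ → stdSimplex ℝ ι) (e l : ℕ) (R C pl : ℝ) (P : ι)
    (hR : 0 < R) (hC : 0 < C)
    (hstake : ∀ j < e, ∀ i, stake j i < 1 / 2)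
    (hpl : ∀ j < e, pl ≤ MLPoS.multiLeaderProb (stake j)) :
    (∀ ε : ℝ, 0 ≤ ε → ε < pl / 2 * R * MLPoS.expectedSlots stake e l P →
      ∀ᶠ q : ℕ in atTop,
        ¬ IsCompliantProtocol (MLPoS.traces ⟨stake, e, l, q⟩) MLPoS.Conflicting
          (MLPoS.rewardUtility ⟨stake, e, l, q⟩ R) (MLPoS.honest ι) ε) ∧
    (∀ t : ℤ, t = ⌊√(pl * R / C)⌋ - 1 → 1 ≤ t →
      ∀ ε : ℝ, 0 ≤ ε →
        ε < (((t : ℝ) - 1) / (2 * ((t : ℝ) + 1)) * pl * R - ((t : ℝ) - 1) * C) *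
          MLPoS.expectedSlots stake e l P →
        ∀ q : ℕ, t ≤ q →
          ¬ IsCompliantProtocol (MLPoS.traces ⟨stake, e, l, q⟩) MLPoS.Conflicting
            (MLPoS.profitUtility ⟨stake, e, l, q⟩ R C) (MLPoS.honest ι) ε) := by
  refine ⟨fun ε hε0 hε => ?_, fun t _ ht1 ε hε0 hε q hq => ?_⟩
  -- Queries are free here, so `t = q`, and `(q - 1) / (2 * (q + 1)) = 1 / 2 - 1 / (q + 1)`.
  · have hlim : Tendsto (fun q : ℕ => ((1 : ℝ) / 2 - 1 / ((q : ℝ) + 1)) * pl * R *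
        MLPoS.expectedSlots stake e l P) atTop
        (nhds ((1 / 2 - 0) * pl * R * MLPoS.expectedSlots stake e l P)) :=
      (((tendsto_const_nhds.sub tendsto_one_div_add_atTop_nhds_zero_nat).mul_const _).mul_const
        _).mul_const _
    have hε' : ε < (1 / 2 - 0) * pl * R * MLPoS.expectedSlots stake e l P := by
      rw [sub_zero]
      linarith
    filter_upwards [hlim.eventually_const_lt hε', eventually_ge_atTop 2] with q hq hq2
    rw [MLPoS.rewardUtility_eq_profitUtility]
    refine MLPoS.not_isCompliantProtocol_profitUtility (P := P) stake e l q hR le_rfl hstake hpl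
      hq2 le_rfl hε0 (hq.trans_eq ?_)
    have : (q : ℝ) + 1 ≠ 0 := by positivity
    field_simp
    ring
  · lift t to ℕ using by omega
    have ht1' : 1 ≤ t := by exact_mod_cast ht1
    -- For `t = 1` the bound on `ε` is `0`, which contradicts `0 ≤ ε`.
    rcases ht1'.eq_or_lt with rfl | ht2
    · norm_num at hε
      linarith
    · exact MLPoS.not_isCompliantProtocol_profitUtility (P := P) stake e l q hR hC.le hstake hpl ht2
        (by exact_mod_cast hq) hε0 (by simpa only [Int.cast_natCast] using hε)
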